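/- Let $l\ge 3$. Equip $\mathbb{R}^{2,l-1}$, with coordinates $(u,t,x_1,\dots,x_{l-1})$, with the form $u^2+t^2-x_1^2-\dots-x_{l-1}^2$. Let $G_l$ be the identity component of $\mathrm{SO}(2,l-1)$, let $H_l\subset G_l$ be the stabilizer of the unit vector $e_u$ (a copy of $\mathrm{SO}(1,l-1)$), and let $AdS_l=G_l/H_l$ with the quotient topology; write $[g]=\pi(g)$ for the class of $g$. In $\mathfrak g=\mathfrak{so}(2,l-1)$ let $J_1$ and $J_2$ be the infinitesimal boosts in the planes $(t,x_1)$ and $(u,x_2)$, $\mathcal A=\langle J_1,J_2\rangle$, $\mathfrak g_{\alpha\beta}=\{X:[J_1,X]=\alpha X,\ [J_2,X]=\beta X\}$, $\mathcal N=\mathfrak g_{1,1}\oplus\mathfrak g_{1,-1}\oplus\mathfrak g_{1,0}\oplus\mathfrak g_{0,1}$, and $\bar{\mathcal N}=\theta\mathcal N$, where $\theta X=-X^{T}$ is the Cartan involution. Let $A,N,\bar N$ be the connected subgroups of $G_l$ generated by the exponentials of $\mathcal A,\mathcal N,\bar{\mathcal N}$; the groups $AN$ and $A\bar N$ act on $AdS_l$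 by left multiplication. * The singularity $\mathscr S_l\subset AdS_l$ is the set of points whose $AN$-orbit or whose $A\bar N$-orbit is closed in $AdS_l$. * Let $\mathcal Q$ be the $(-1)$-eigenspace of the involution $\sigma=\mathrm{Ad}(\mathrm{diag}(-1,1,\dots,1))$ of $\mathfrak g$, and let $q_0\in\mathcal Q$ be the generator of the rotations of the plane $(u,t)$. A future light-like direction is a nilpotent $E\in\mathcal Q$ whose component along $q_0$ is positive. The light-like geodesics through $[g]$ are $s\mapsto\pi(g\,e^{sE})$ with $E$ such a direction; their points with $s>0$ are in the future of $[g]$. * The black hole $BH_l$ is the set of points $p\in AdS_l$ such that every light-like geodesic through $p$ meets $\mathscr S_l$ in the future (for some $s>0$). The free part $\mathscr F_l$ is the set of points $p\in AdS_l$ such that some light-like geodesic through $p$ does not meet $\mathscr S_l$ in the future (for any $s>0$). * The horizon $\mathscr H_l$ is the topological boundary of $BH_l$ in $AdS_l$. Let $\iota\colon AdS_l\to AdS_{l+1}$ be the inclusion $\iota([g])=[\mathrm{diag}(g,1)]$. Then for every $l\ge 3$: $$\iota(\mathscr S_l)\subset\mathscr S_{l+1},\qquad \iota(\mathscr F_l)\subset\mathscr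 F_{l+1},\qquad \iota(BH_l)\subset BH_{l+1},\qquad \iota(\mathscr H_l)\subset\mathscr H_{l+1},$$ $$\mathscr F_{l+1}\cap\iota(AdS_l)\subset\iota(\mathscr F_l),\qquad \mathscr H_{l+1}\cap\iota(AdS_l)\subset\iota(\mathscr H_l).$$ -/

import Mathlib

namespace BTZ

open Matrix

attribute [local instance 100] LieRing.ofAssociativeRing

/-! Throughout, `m : ℕ` and `l = m + 3`.  The space `AdS m` below is the `l`-dimensional anti de
Sitter space.  The coordinates of `ℝ^{2,l-1}` are `u = inl 0`, `t = inl 1` (positive directions)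
and `x_1 = inr 0`, `x_2 = inr 1`, ..., `x_{l-1} = inr (m + 1)` (negative directions). -/

/-- Indices of the coordinates of `ℝ^{2,l-1}`. -/
abbrev Ix (m : ℕ) : Type := Fin 2 ⊕ Fin (m + 2)

/-- The Gram matrix `diag(1, 1, -1, ..., -1)` of signature `(2, l-1)`. -/
noncomputable abbrev eta (m : ℕ) : Matrix (Ix m) (Ix m) ℝ :=
  LieAlgebra.Orthogonal.indefiniteDiagonal (Fin 2) (Fin (m + 2)) ℝ

/-- The Lie algebra `so(2, l-1)`. -/
noncomputable abbrev so (m : ℕ) : LieSubalgebra ℝ (Matrix (Ix m) (Ix m) ℝ) :=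
  LieAlgebra.Orthogonal.so' (Fin 2) (Fin (m + 2)) ℝ

theorem mem_so {m : ℕ} (X : Matrix (Ix m) (Ix m) ℝ) :
    X ∈ so m ↔ Xᵀ * eta m = eta m * (-X) := by
  rw [so, LieAlgebra.Orthogonal.so', mem_skewAdjointMatricesLieSubalgebra,
    mem_skewAdjointMatricesSubmodule]
  rfl

theorem eta_mul_eta (m : ℕ) : eta m * eta m = 1 := by
  rw [eta, LieAlgebra.Orthogonal.indefiniteDiagonal, Matrix.diagonal_mul_diagonal,
    ← Matrix.diagonal_one]
  congr 1
  ext i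
  rcases i with i | i <;> simp

/-- The group `SO(2, l-1)`. -/
noncomputable def SO (m : ℕ) : Subgroup (SpecialLinearGroup (Ix m) ℝ) where
  carrier := {g | (g : Matrix (Ix m) (Ix m) ℝ)ᵀ * eta m * (g : Matrix (Ix m) (Ix m) ℝ) = eta m}
  one_mem' := by simp
  mul_mem' := by
    intro a b ha hb
    change (a.1 * b.1)ᵀ * eta m * (a.1 * b.1) = eta m
    change a.1ᵀ * eta m * a.1 = eta m at ha
    change b.1ᵀ * eta m * b.1 = eta m at hb
    calc (a.1 * b.1)ᵀ * eta m * (a.1 * b.1) = b.1ᵀ * (a.1ᵀ * eta m * a.1) * b.1 := by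
          simp only [transpose_mul, Matrix.mul_assoc]
      _ = eta m := by rw [ha, hb]
  inv_mem' := by
    intro a ha
    change a.1ᵀ * eta m * a.1 = eta m at ha
    have h1 : a.1 * (a⁻¹).1 = 1 := congrArg Subtype.val (mul_inv_cancel a)
    change (a⁻¹).1ᵀ * eta m * (a⁻¹).1 = eta m
    have h2 : (a⁻¹).1ᵀ * a.1ᵀ = 1 := by rw [← transpose_mul, h1, transpose_one]
    calc (a⁻¹).1ᵀ * eta m * (a⁻¹).1 = (a⁻¹).1ᵀ * (a.1ᵀ * eta m * a.1) * (a⁻¹).1 := by rw [ha]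
      _ = ((a⁻¹).1ᵀ * a.1ᵀ) * eta m * (a.1 * (a⁻¹).1) := by simp only [Matrix.mul_assoc]
      _ = eta m := by rw [h1, h2, Matrix.one_mul, Matrix.mul_one]

/-- The isometry group `G`: the identity component of `SO(2, l-1)`. -/
noncomputable def G (m : ℕ) : Subgroup (SO m) := Subgroup.connectedComponentOfOne (SO m)

/-- The matrix of an element of `G`. -/
def mat {m : ℕ} (g : G m) : Matrix (Ix m) (Ix m) ℝ := ((g : SO m) : SpecialLinearGroup (Ix m) ℝ)

theorem mat_mul {m : ℕ} (g h : G m) : mat (g * h) = mat g * mat h := rfl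

theorem mat_one {m : ℕ} : mat (1 : G m) = 1 := rfl

/-- The base vector `e_u` of `ℝ^{2,l-1}`. -/
def baseVec (m : ℕ) : Ix m → ℝ := Pi.single (Sum.inl 0) 1

/-- The subgroup `H`, that is `SO(1, l-1)` embedded in `G` as the stabilizer of `e_u`. -/
noncomputable def H (m : ℕ) : Subgroup (G m) where
  carrier := {g | mat g *ᵥ baseVec m = baseVec m}
  one_mem' := by simp [mat_one]
  mul_mem' := by
    intro a b ha hb
    change mat a *ᵥ baseVec m = baseVec m at ha
    change mat b *ᵥ baseVec m = baseVec m at hb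
    change mat (a * b) *ᵥ baseVec m = baseVec m
    rw [mat_mul, ← Matrix.mulVec_mulVec, hb, ha]
  inv_mem' := by
    intro a ha
    change mat a *ᵥ baseVec m = baseVec m at ha
    change mat a⁻¹ *ᵥ baseVec m = baseVec m
    conv_lhs => rw [← ha]
    rw [Matrix.mulVec_mulVec, ← mat_mul, inv_mul_cancel, mat_one, Matrix.one_mulVec]

/-- Anti de Sitter space of dimension `l = m + 3`, as the homogeneous space `G / H`
with its quotient topology. -/
abbrev AdS (m : ℕ) : Type := G m ⧸ H m

/-! ### The exponential map -/

theorem exp_isometry {m : ℕ} (X : so m) :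
    (NormedSpace.exp (X : Matrix (Ix m) (Ix m) ℝ))ᵀ * eta m
      * NormedSpace.exp (X : Matrix (Ix m) (Ix m) ℝ) = eta m := by
  obtain ⟨X, hX⟩ := X
  have hX' : Xᵀ * eta m = eta m * (-X) := (mem_so X).1 hX
  have hee := eta_mul_eta m
  have hu : IsUnit (eta m) := IsUnit.of_mul_eq_one _ hee
  have hinv : (eta m)⁻¹ = eta m := Matrix.inv_eq_right_inv hee
  have hT : Xᵀ = eta m * (-X) * (eta m)⁻¹ := by
    rw [hinv, ← hX', Matrix.mul_assoc, hee, Matrix.mul_one]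
  have h1 : (NormedSpace.exp X)ᵀ = eta m * (NormedSpace.exp X)⁻¹ * eta m := by
    rw [← Matrix.exp_transpose, hT, Matrix.exp_conj _ _ hu, Matrix.exp_neg, hinv]
  have h2 : (NormedSpace.exp X)⁻¹ * NormedSpace.exp X = 1 :=
    Matrix.nonsing_inv_mul _ ((Matrix.isUnit_iff_isUnit_det _).1 (Matrix.isUnit_exp X))
  show (NormedSpace.exp X)ᵀ * eta m * NormedSpace.exp X = eta m
  rw [h1]
  calc eta m * (NormedSpace.exp X)⁻¹ * eta m * eta m * NormedSpace.exp X
      = eta m * (NormedSpace.exp X)⁻¹ * (eta m * eta m) * NormedSpace.exp X := by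
        simp only [Matrix.mul_assoc]
    _ = eta m := by rw [hee, Matrix.mul_one, Matrix.mul_assoc, h2, Matrix.mul_one]

theorem det_exp_eq_one {m : ℕ} (X : so m) :
    (NormedSpace.exp (X : Matrix (Ix m) (Ix m) ℝ)).det = 1 := by
  have hne : (eta m).det ≠ 0 := by
    simp [eta, LieAlgebra.Orthogonal.indefiniteDiagonal]
  have h1 : (NormedSpace.exp (X : Matrix (Ix m) (Ix m) ℝ)).det ^ 2 = 1 := by
    have h := congrArg Matrix.det (exp_isometry X)
    rw [Matrix.det_mul, Matrix.det_mul, Matrix.det_transpose] at h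
    apply mul_right_cancel₀ hne
    linear_combination h
  have h2 : 0 ≤ (NormedSpace.exp (X : Matrix (Ix m) (Ix m) ℝ)).det := by
    have h : (X : Matrix (Ix m) (Ix m) ℝ) = (2 : ℕ) • ((2⁻¹ : ℝ) • (X : Matrix (Ix m) (Ix m) ℝ)) := by
      ext i j; simp
    rw [h, Matrix.exp_nsmul, Matrix.det_pow]
    positivity
  nlinarith

/-- `exp X` as an element of `SO(2, l-1)`. -/
noncomputable def expSO {m : ℕ} (X : so m) : SO m :=
  ⟨⟨NormedSpace.exp (X : Matrix (Ix m) (Ix m) ℝ), det_exp_eq_one X⟩, exp_isometry X⟩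

theorem expSO_mem {m : ℕ} (X : so m) : expSO X ∈ G m := by
  have hc : Continuous fun s : ℝ => expSO (s • X) := by
    refine Continuous.subtype_mk (Continuous.subtype_mk ?_ _) _
    let : NormedRing (Matrix (Ix m) (Ix m) ℝ) := Matrix.linftyOpNormedRing
    let : NormedAlgebra ℝ (Matrix (Ix m) (Ix m) ℝ) := Matrix.linftyOpNormedAlgebra
    let : NormedAlgebra ℚ (Matrix (Ix m) (Ix m) ℝ) := NormedAlgebra.restrictScalars ℚ ℝ _
    have : Continuous fun s : ℝ => s • (X : Matrix (Ix m) (Ix m) ℝ) := by fun_prop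
    exact NormedSpace.exp_continuous.comp this
  have hp : IsPreconnected (Set.range fun s : ℝ => expSO (s • X)) := isPreconnected_range hc
  have h0 : (1 : SO m) ∈ Set.range fun s : ℝ => expSO (s • X) := by
    refine ⟨0, ?_⟩
    apply Subtype.ext; apply Subtype.ext
    simp [expSO]
  exact hp.subset_connectedComponent h0 ⟨1, by simp⟩

/-- The exponential map `so(2, l-1) → G`. -/
noncomputable def expG {m : ℕ} (X : so m) : G m := ⟨expSO X, expSO_mem X⟩

/-! ### The Iwasawa groups -/

/-- `J₁`, the infinitesimal boost in the plane `(t, x_1)`; it lies in the Lie algebra of `H`. -/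
noncomputable def J₁ (m : ℕ) : so m :=
  ⟨Matrix.single (Sum.inl 1) (Sum.inr 0) 1 + Matrix.single (Sum.inr 0) (Sum.inl 1) 1, by
    rw [mem_so]
    ext i j
    rcases i with i | i <;> rcases j with j | j <;>
      simp [eta, LieAlgebra.Orthogonal.indefiniteDiagonal, Matrix.single_apply, and_comm] <;>
      split_ifs <;> simp⟩

/-- `J₂`, the infinitesimal boost in the plane `(u, x_2)`; it lies in `𝒬`. -/
noncomputable def J₂ (m : ℕ) : so m :=
  ⟨Matrix.single (Sum.inl 0) (Sum.inr 1) 1 + Matrix.single (Sum.inr 1) (Sum.inl 0) 1, by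
    rw [mem_so]
    ext i j
    rcases i with i | i <;> rcases j with j | j <;>
      simp [eta, LieAlgebra.Orthogonal.indefiniteDiagonal, Matrix.single_apply, and_comm] <;>
      split_ifs <;> simp⟩

/-- `𝒜 = ⟨J₁, J₂⟩`. -/
noncomputable def lieA (m : ℕ) : Submodule ℝ (so m) := Submodule.span ℝ {J₁ m, J₂ m}

/-- The space of all `X` with `[J₁, X] = α X` and `[J₂, X] = β X`. -/
noncomputable def rootSpace (m : ℕ) (α β : ℝ) : Submodule ℝ (so m) where
  carrier := {X | ⁅J₁ m, X⁆ = α • X ∧ ⁅J₂ m, X⁆ = β • X}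
  zero_mem' := by simp
  add_mem' := by
    rintro X Y ⟨h1, h2⟩ ⟨h3, h4⟩
    exact ⟨by rw [lie_add, h1, h3, smul_add], by rw [lie_add, h2, h4, smul_add]⟩
  smul_mem' := by
    rintro c X ⟨h1, h2⟩
    exact ⟨by rw [lie_smul, h1, smul_comm], by rw [lie_smul, h2, smul_comm]⟩

/-- `𝒩`, spanned by the root vectors `X_{++}`, `X_{+-}`, `X_{+0}^k`, `X_{0+}^k`. -/
noncomputable def lieN (m : ℕ) : Submodule ℝ (so m) :=
  rootSpace m 1 1 ⊔ rootSpace m 1 (-1) ⊔ rootSpace m 1 0 ⊔ rootSpace m 0 1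

theorem theta_mem {m : ℕ} {X : Matrix (Ix m) (Ix m) ℝ} (hX : X ∈ so m) : -Xᵀ ∈ so m := by
  have hX' : Xᵀ * eta m = eta m * (-X) := (mem_so X).1 hX
  have hee := eta_mul_eta m
  rw [mem_so]
  have hT : Xᵀ = eta m * (-X) * eta m := by
    rw [← hX', Matrix.mul_assoc, hee, Matrix.mul_one]
  rw [neg_neg, transpose_neg, transpose_transpose, hT, ← Matrix.mul_assoc, ← Matrix.mul_assoc, hee,
    Matrix.one_mul]

/-- The Cartan involution `θ X = - Xᵀ`. -/
noncomputable def theta (m : ℕ) : so m →ₗ[ℝ] so m where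
  toFun X := ⟨-(X : Matrix (Ix m) (Ix m) ℝ)ᵀ, theta_mem X.2⟩
  map_add' X Y := by ext i j; simp [add_comm]
  map_smul' c X := by ext i j; simp

/-- `𝒩̄ = θ 𝒩`. -/
noncomputable def lieNbar (m : ℕ) : Submodule ℝ (so m) := (lieN m).map (theta m)

/-- The subgroup of `G` generated by the exponentials of the elements of `V`. -/
noncomputable def expSubgroup {m : ℕ} (V : Submodule ℝ (so m)) : Subgroup (G m) :=
  Subgroup.closure (expG '' (V : Set (so m)))

/-- The Iwasawa group `AN`. -/
noncomputable def AN (m : ℕ) : Subgroup (G m) := expSubgroup (lieA m) ⊔ expSubgroup (lieN m)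

/-- The Iwasawa group `AN̄`. -/
noncomputable def ANbar (m : ℕ) : Subgroup (G m) := expSubgroup (lieA m) ⊔ expSubgroup (lieNbar m)

/-! ### The causal structure -/

/-- The singularity: the points of the closed orbits of `AN` and of `AN̄`. -/
def singularity (m : ℕ) : Set (AdS m) :=
  {p | IsClosed (MulAction.orbit (AN m) p)} ∪ {p | IsClosed (MulAction.orbit (ANbar m) p)}

/-- `diag(-1, 1, ..., 1)`, which defines the involution `σ`. -/
def sigmaMat (m : ℕ) : Matrix (Ix m) (Ix m) ℝ :=
  Matrix.diagonal fun i => if i = Sum.inl 0 then -1 else 1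

/-- The tangent space `𝒬` of `G / H` at the base point: the `-1` eigenspace of the involutive
automorphism `σ X = S X S`, `S = diag(-1, 1, ..., 1)`, whose fixed points form the Lie algebra
of `H`. -/
def Q (m : ℕ) : Set (so m) :=
  {X | sigmaMat m * (X : Matrix (Ix m) (Ix m) ℝ) * sigmaMat m = -(X : Matrix (Ix m) (Ix m) ℝ)}

/-- Future light-like directions: the nilpotent `E ∈ 𝒬` whose component on the generator
`q₀` of rotations in the plane `(u, t)`, i.e. the entry `E t u`, is positive.  Up to
positive factors they are the `q₀ + ∑ w_i q_i` with `∑ w_i ^ 2 = 1`. -/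
def IsFutureLightlike {m : ℕ} (E : so m) : Prop :=
  E ∈ Q m ∧ IsNilpotent (E : Matrix (Ix m) (Ix m) ℝ) ∧
    0 < (E : Matrix (Ix m) (Ix m) ℝ) (Sum.inl 1) (Sum.inl 0)

/-- The geodesic `s ↦ π(g exp(s E))` issued from `π(g)` in the direction `E`. -/
noncomputable def geodesic {m : ℕ} (g : G m) (E : so m) (s : ℝ) : AdS m :=
  QuotientGroup.mk (g * expG (s • E))

/-- The black hole: every light-like geodesic through the point meets the singularity in the
future. -/
def blackHole (m : ℕ) : Set (AdS m) :=
  {p | ∀ g : G m, (QuotientGroup.mk g : AdS m) = p → ∀ E : so m, IsFutureLightlike E →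
    ∃ s : ℝ, 0 < s ∧ geodesic g E s ∈ singularity m}

/-- The free part: some light-like geodesic through the point escapes the singularity in the
future. -/
def freePart (m : ℕ) : Set (AdS m) :=
  {p | ∃ g : G m, (QuotientGroup.mk g : AdS m) = p ∧ ∃ E : so m, IsFutureLightlike E ∧
    ∀ s : ℝ, 0 < s → geodesic g E s ∉ singularity m}

/-- The horizon: the boundary of the black hole. -/
def horizon (m : ℕ) : Set (AdS m) := frontier (blackHole m)

/-! ### The inclusion of `AdS_l` into `AdS_{l+1}` -/

/-- The coordinates of `ℝ^{2,l}` are those of `ℝ^{2,l-1}` together with a last one. -/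
def ixEquiv (m : ℕ) : Ix m ⊕ Fin 1 ≃ Ix (m + 1) :=
  (Equiv.sumAssoc (Fin 2) (Fin (m + 2)) (Fin 1)).trans
    (Equiv.sumCongr (Equiv.refl (Fin 2)) finSumFinEquiv)

/-- The block matrix `diag(M, 1)`. -/
def embMat {m : ℕ} (M : Matrix (Ix m) (Ix m) ℝ) : Matrix (Ix (m + 1)) (Ix (m + 1)) ℝ :=
  Matrix.reindex (ixEquiv m) (ixEquiv m) (Matrix.fromBlocks M 0 0 1)

theorem embMat_mul {m : ℕ} (M N : Matrix (Ix m) (Ix m) ℝ) :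
    embMat (M * N) = embMat M * embMat N := by
  simp [embMat, Matrix.submatrix_mul_equiv, Matrix.fromBlocks_multiply]

theorem embMat_one {m : ℕ} : embMat (1 : Matrix (Ix m) (Ix m) ℝ) = 1 := by
  simp [embMat]

theorem embMat_det {m : ℕ} (M : Matrix (Ix m) (Ix m) ℝ) : (embMat M).det = M.det := by
  simp [embMat]

theorem embMat_isometry {m : ℕ} {M : Matrix (Ix m) (Ix m) ℝ} (h : Mᵀ * eta m * M = eta m) :
    (embMat M)ᵀ * eta (m + 1) * embMat M = eta (m + 1) := by
  have he : eta (m + 1) =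
      Matrix.reindex (ixEquiv m) (ixEquiv m) (Matrix.fromBlocks (eta m) 0 0 (-1)) := by
    rw [← Equiv.symm_apply_eq]
    ext i j
    rcases i with (i | i) | i <;> rcases j with (j | j) | j <;>
      simp [ixEquiv, eta, LieAlgebra.Orthogonal.indefiniteDiagonal, Matrix.diagonal_apply,
        Matrix.one_apply, Fin.ext_iff] <;> omega
  rw [he, embMat]
  simp [Matrix.submatrix_mul_equiv, Matrix.fromBlocks_multiply, Matrix.fromBlocks_transpose, h]

/-- The inclusion `SO(2, l-1) → SO(2, l)`. -/
def embSO (m : ℕ) : SO m →* SO (m + 1) where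
  toFun g := ⟨⟨embMat ((g : SpecialLinearGroup (Ix m) ℝ) : Matrix (Ix m) (Ix m) ℝ),
    by rw [embMat_det]; exact (g : SpecialLinearGroup (Ix m) ℝ).2⟩, embMat_isometry g.2⟩
  map_one' := by
    apply Subtype.ext; apply Subtype.ext
    exact embMat_one
  map_mul' a b := by
    apply Subtype.ext; apply Subtype.ext
    exact embMat_mul _ _

theorem embSO_continuous (m : ℕ) : Continuous (embSO m) := by
  refine Continuous.subtype_mk (Continuous.subtype_mk ?_ _) _
  have h : Continuous fun g : SO m =>
      ((g : SpecialLinearGroup (Ix m) ℝ) : Matrix (Ix m) (Ix m) ℝ) :=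
    continuous_subtype_val.comp continuous_subtype_val
  exact (Continuous.matrix_fromBlocks h continuous_const continuous_const
    continuous_const).matrix_submatrix _ _

theorem embSO_mem {m : ℕ} {g : SO m} (hg : g ∈ G m) : embSO m g ∈ G (m + 1) := by
  have h := (embSO_continuous m).image_connectedComponent_subset (1 : SO m)
  rw [map_one] at h
  exact h ⟨g, hg, rfl⟩

/-- The inclusion `G_l → G_{l+1}`. -/
noncomputable def embG (m : ℕ) : G m →* G (m + 1) :=
  ((embSO m).comp (G m).subtype).codRestrict (G (m + 1)) fun g => embSO_mem g.2

theorem embG_mem {m : ℕ} {g : G m} (hg : g ∈ H m) : embG m g ∈ H (m + 1) := by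
  have h : mat g *ᵥ baseVec m = baseVec m := hg
  show embMat (mat g) *ᵥ baseVec (m + 1) = baseVec (m + 1)
  have hb : baseVec (m + 1) = Sum.elim (baseVec m) 0 ∘ (ixEquiv m).symm := by
    rw [Equiv.eq_comp_symm]
    ext i
    rcases i with (i | i) | i <;> simp [baseVec, ixEquiv, Pi.single_apply]
  rw [hb, embMat, Matrix.reindex_apply, Matrix.submatrix_mulVec_equiv]
  simp [Function.comp_assoc, Matrix.fromBlocks_mulVec, h]

/-- The inclusion `ι : AdS_l → AdS_{l+1}`, `ι [g] = [diag(g, 1)]`. -/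
noncomputable def iota (m : ℕ) : AdS m → AdS (m + 1) :=
  Quotient.map' (embG m) fun a b hab => by
    rw [QuotientGroup.leftRel_apply] at *
    have h := embG_mem hab
    rwa [map_mul, map_inv] at h

end BTZ

namespace BTZ

open Matrix

attribute [local instance 100] LieRing.ofAssociativeRing

/-! ### The exponential of a matrix applied to a vector -/

section Exp

variable {n : Type*} [Fintype n] [DecidableEq n]

/-! The map `g ↦ g e_u` identifies `AdS_l` with a part of the quadric `⟨v, v⟩ = 1`, and there all
the data become elementary. The groups `AN` and `AN̄` (signs `ε = 1` and `ε = -1`) stabilise the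
flag spanned by `f = e_t + ε e_{x_1}` and `h = e_u + ε e_{x_2}`, with positive diagonal
coefficients. Hence the sign of `⟨f, v⟩` is an orbit invariant. An orbit with `⟨f, v⟩ ≠ 0` is not
closed, and one with `⟨f, v⟩ = 0` is closed. The singularity is therefore `t ^ 2 = x_1 ^ 2`
(`mem_singularity`). The future light-like geodesics are the straight lines `g (e_u + s k)` with `k`
null, orthogonal to `e_u` and `k_t > 0` (`mk_mem_freePart`).

The inclusion `ι` appends a zero coordinate, which the equation of the singularity does not see. A
null direction upstairs is `(k, c)` with `⟨k, k⟩ = c ^ 2`, and only `k` matters for meeting the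
singularity. If `c ≠ 0` then `k` is time-like, and `exists_lightlike` deforms it to a null direction
that still escapes. So `ι` pulls the free part back to the free part exactly, and likewise its
complement, the black hole.

The horizon is the intersection of the closures of these two sets. Continuity of `ι` pushes closures
forward. Conversely, rotations of the last two coordinates preserve both sets upstairs and bring any
point near `ι p` to some `ι q` with `q` near `p` (`mem_closure_of_iota_mem_closure`). This requires
the map to the quadric to be open, which is shown with products of reflections
(`eventually_exists_pt_eq`). -/

theorem hasSum_exp_mulVec (X : Matrix n n ℝ) (v : n → ℝ) :
    HasSum (fun k : ℕ => ((k.factorial : ℝ)⁻¹) • (X ^ k *ᵥ v)) (NormedSpace.exp X *ᵥ v) := by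
  let : NormedRing (Matrix n n ℝ) := Matrix.linftyOpNormedRing
  let : NormedAlgebra ℝ (Matrix n n ℝ) := Matrix.linftyOpNormedAlgebra
  let : NormedAlgebra ℚ (Matrix n n ℝ) := NormedAlgebra.restrictScalars ℚ ℝ _
  have h := NormedSpace.exp_series_hasSum_exp' (𝕂 := ℝ) X
  have hc : Continuous fun M : Matrix n n ℝ => M *ᵥ v :=
    Continuous.matrix_mulVec continuous_id continuous_const
  have h2 := h.map (AddMonoidHom.mk' (fun M : Matrix n n ℝ => M *ᵥ v)
    fun A B => Matrix.add_mulVec A B v) hc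
  refine h2.congr_fun fun k => ?_
  exact (Matrix.smul_mulVec _ _ _).symm

theorem pow_mulVec_eigen {X : Matrix n n ℝ} {v : n → ℝ} {c : ℝ} (h : X *ᵥ v = c • v) (k : ℕ) :
    X ^ k *ᵥ v = c ^ k • v := by
  induction k with
  | zero => simp
  | succ k ih => rw [pow_succ', ← Matrix.mulVec_mulVec, ih, Matrix.mulVec_smul, h, smul_smul, pow_succ]

theorem exp_mulVec_eigen {X : Matrix n n ℝ} {v : n → ℝ} {c : ℝ} (h : X *ᵥ v = c • v) :
    NormedSpace.exp X *ᵥ v = Real.exp c • v := by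
  refine (hasSum_exp_mulVec X v).unique ?_
  have h1 : HasSum (fun k : ℕ => ((k.factorial : ℝ)⁻¹) • c ^ k) (Real.exp c) := by
    rw [Real.exp_eq_exp_ℝ]
    exact NormedSpace.exp_series_hasSum_exp' (𝕂 := ℝ) c
  have h2 := h1.smul_const v
  refine h2.congr_fun fun k => ?_
  rw [pow_mulVec_eigen h, smul_assoc]

theorem exp_mulVec_of_pow_eq_zero {X : Matrix n n ℝ} {v : n → ℝ} {N : ℕ} (h : X ^ N *ᵥ v = 0) :
    NormedSpace.exp X *ᵥ v = ∑ k ∈ Finset.range N, ((k.factorial : ℝ)⁻¹) • (X ^ k *ᵥ v) := by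
  refine (hasSum_exp_mulVec X v).unique (hasSum_sum_of_ne_finset_zero fun k hk => ?_)
  obtain ⟨j, rfl⟩ := Nat.exists_eq_add_of_le (not_lt.1 (Finset.mem_range.not.1 hk))
  rw [add_comm, pow_add, ← Matrix.mulVec_mulVec, h, Matrix.mulVec_zero, smul_zero]

theorem exp_mulVec_of_sq {X : Matrix n n ℝ} {v : n → ℝ} (h : X *ᵥ (X *ᵥ v) = 0) :
    NormedSpace.exp X *ᵥ v = v + X *ᵥ v := by
  rw [exp_mulVec_of_pow_eq_zero (N := 2) (by rw [pow_two, ← Matrix.mulVec_mulVec, h])]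
  simp [Finset.sum_range_succ]

theorem exp_mulVec_of_cube {X : Matrix n n ℝ} {v : n → ℝ} (h : X *ᵥ (X *ᵥ (X *ᵥ v)) = 0) :
    NormedSpace.exp X *ᵥ v = v + X *ᵥ v + (2⁻¹ : ℝ) • (X *ᵥ (X *ᵥ v)) := by
  rw [exp_mulVec_of_pow_eq_zero (N := 3) (by rw [pow_succ, pow_two, ← Matrix.mulVec_mulVec,
    ← Matrix.mulVec_mulVec, h])]
  simp [Finset.sum_range_succ, pow_two]

theorem exp_mulVec_rotation {X : Matrix n n ℝ} {v : n → ℝ} (h : X *ᵥ (X *ᵥ v) = -v) (θ : ℝ) :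
    NormedSpace.exp (θ • X) *ᵥ v = Real.cos θ • v + Real.sin θ • (X *ᵥ v) := by
  have h2 : ∀ k : ℕ, X ^ (2 * k) *ᵥ v = (-1 : ℝ) ^ k • v := fun k => by
    rw [pow_mul]
    exact pow_mulVec_eigen (by rw [pow_two, ← Matrix.mulVec_mulVec, h, neg_one_smul]) k
  refine (hasSum_exp_mulVec (θ • X) v).unique (HasSum.even_add_odd ?_ ?_)
  · refine ((Real.hasSum_cos θ).smul_const v).congr_fun fun k => ?_
    rw [smul_pow, Matrix.smul_mulVec, h2, smul_smul, smul_smul]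
    congr 1
    ring
  · refine ((Real.hasSum_sin θ).smul_const (X *ᵥ v)).congr_fun fun k => ?_
    rw [smul_pow, Matrix.smul_mulVec, pow_succ' X, ← Matrix.mulVec_mulVec, h2, Matrix.mulVec_smul,
      smul_smul, smul_smul]
    congr 1
    ring

end Exp

/-! ### The quadratic form -/

/-- The bilinear form `u u' + t t' - x_1 x_1' - ...`. -/
noncomputable def ip {m : ℕ} (x y : Ix m → ℝ) : ℝ := x ⬝ᵥ eta m *ᵥ y

section Form

variable {m : ℕ} (x y z : Ix m → ℝ) (c : ℝ)

theorem eta_mulVec : eta m *ᵥ x = Sum.elim (fun i => x (Sum.inl i)) fun j => -x (Sum.inr j) := by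
  ext i
  rcases i with i | i <;> simp [eta, LieAlgebra.Orthogonal.indefiniteDiagonal, mulVec_diagonal]

theorem ip_eq : ip x y = x (Sum.inl 0) * y (Sum.inl 0) + x (Sum.inl 1) * y (Sum.inl 1)
    - ∑ j, x (Sum.inr j) * y (Sum.inr j) := by
  simp [ip, eta_mulVec, dotProduct, sub_eq_add_neg]

theorem ip_comm : ip x y = ip y x := by
  simp only [ip_eq, mul_comm]

theorem ip_add_left : ip (x + y) z = ip x z + ip y z := by simp [ip, add_dotProduct]
theorem ip_sub_left : ip (x - y) z = ip x z - ip y z := by simp [ip, sub_dotProduct]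
theorem ip_smul_left : ip (c • x) y = c * ip x y := by simp [ip, smul_dotProduct]
theorem ip_add_right : ip x (y + z) = ip x y + ip x z := by simp [ip, mulVec_add, dotProduct_add]
theorem ip_sub_right : ip x (y - z) = ip x y - ip x z := by simp [ip, mulVec_sub, dotProduct_sub]
theorem ip_smul_right : ip x (c • y) = c * ip x y := by
  simp [ip, mulVec_smul, dotProduct_smul]
theorem ip_neg_right : ip x (-y) = -ip x y := by simp [ip, mulVec_neg, dotProduct_neg]

theorem ip_single_inl (i : Fin 2) : ip (Pi.single (Sum.inl i) 1) x = x (Sum.inl i) := by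
  simp [ip, eta_mulVec]

theorem ip_single_inr (j : Fin (m + 2)) : ip (Pi.single (Sum.inr j) 1) x = -x (Sum.inr j) := by
  simp [ip, eta_mulVec]

theorem mat_ext {A B : Matrix (Ix m) (Ix m) ℝ} (h : ∀ x, A *ᵥ x = B *ᵥ x) : A = B :=
  Matrix.ext_of_mulVec_single fun _ => h _

theorem ip_mulVec_mulVec (A B : Matrix (Ix m) (Ix m) ℝ) :
    ip (A *ᵥ x) (B *ᵥ y) = x ⬝ᵥ (Aᵀ * eta m * B) *ᵥ y := by
  rw [ip, Matrix.dotProduct_mulVec, Matrix.vecMul_mulVec]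
  simp only [Matrix.dotProduct_mulVec, Matrix.vecMul_vecMul, Matrix.mul_assoc]

theorem isometry_iff {A : Matrix (Ix m) (Ix m) ℝ} :
    Aᵀ * eta m * A = eta m ↔ ∀ x y, ip (A *ᵥ x) (A *ᵥ y) = ip x y := by
  constructor
  · intro h x y
    rw [ip_mulVec_mulVec, h, ip]
  · intro h
    ext i j
    have := h (Pi.single i 1) (Pi.single j 1)
    rw [ip_mulVec_mulVec, ip] at this
    simpa using this

theorem mem_so_iff {X : Matrix (Ix m) (Ix m) ℝ} :
    X ∈ so m ↔ ∀ x y, ip (X *ᵥ x) y = -ip x (X *ᵥ y) := by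
  have key : ∀ x y, ip (X *ᵥ x) y = x ⬝ᵥ (Xᵀ * eta m) *ᵥ y ∧
      -ip x (X *ᵥ y) = x ⬝ᵥ (eta m * (-X)) *ᵥ y := fun x y => by
    have h1 := ip_mulVec_mulVec x y X 1
    have h2 := ip_mulVec_mulVec x y 1 X
    simp only [Matrix.one_mulVec, Matrix.transpose_one, Matrix.one_mul, Matrix.mul_one] at h1 h2
    rw [h1, h2, Matrix.mul_neg, Matrix.neg_mulVec, dotProduct_neg]
    exact ⟨rfl, rfl⟩
  rw [mem_so]
  constructor
  · intro h x y
    rw [(key x y).1, (key x y).2, h]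
  · intro h
    ext i j
    have := h (Pi.single i 1) (Pi.single j 1)
    rw [(key _ _).1, (key _ _).2] at this
    simpa using this

end Form

theorem ip_mat {m : ℕ} (g : G m) (x y : Ix m → ℝ) : ip (mat g *ᵥ x) (mat g *ᵥ y) = ip x y :=
  isometry_iff.1 g.1.2 x y

theorem mat_inv_mulVec {m : ℕ} (g : G m) (x : Ix m → ℝ) : mat g⁻¹ *ᵥ (mat g *ᵥ x) = x := by
  rw [Matrix.mulVec_mulVec, ← mat_mul, inv_mul_cancel, mat_one, Matrix.one_mulVec]

theorem mat_mulVec_inv {m : ℕ} (g : G m) (x : Ix m → ℝ) : mat g *ᵥ (mat g⁻¹ *ᵥ x) = x := by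
  rw [Matrix.mulVec_mulVec, ← mat_mul, mul_inv_cancel, mat_one, Matrix.one_mulVec]

theorem mat_expG {m : ℕ} (X : so m) :
    mat (expG X) = NormedSpace.exp (X : Matrix (Ix m) (Ix m) ℝ) := rfl

theorem vecMulVec_eta_mulVec {m : ℕ} (p q z : Ix m → ℝ) :
    vecMulVec p (eta m *ᵥ q) *ᵥ z = ip q z • p := by
  rw [vecMulVec_mulVec, ip_comm, ip, dotProduct_comm]
  simp

/-- The element `x ↦ ⟨a, x⟩ b - ⟨b, x⟩ a` of `so(2, l-1)`. -/
noncomputable def wedge {m : ℕ} (a b : Ix m → ℝ) : so m :=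
  ⟨vecMulVec b (eta m *ᵥ a) - vecMulVec a (eta m *ᵥ b), by
    refine mem_so_iff.2 fun x y => ?_
    simp only [sub_mulVec, vecMulVec_eta_mulVec, ip_sub_left, ip_sub_right, ip_smul_left, ip_smul_right,
      ip_comm x a, ip_comm x b]
    ring⟩

theorem wedge_mulVec {m : ℕ} (a b x : Ix m → ℝ) :
    (wedge a b : Matrix (Ix m) (Ix m) ℝ) *ᵥ x = ip a x • b - ip b x • a := by
  simp only [wedge, sub_mulVec, vecMulVec_eta_mulVec]

/-! ### The quadric model -/

/-- The point `g e_u` of the quadric `⟨v, v⟩ = 1` defined by the class of `g`. -/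
noncomputable def pt {m : ℕ} : AdS m → Ix m → ℝ :=
  Quotient.lift (fun g : G m => mat g *ᵥ baseVec m) fun a b hab => by
    have h : a⁻¹ * b ∈ H m := QuotientGroup.leftRel_apply.1 hab
    change mat (a⁻¹ * b) *ᵥ baseVec m = baseVec m at h
    rw [mat_mul, ← Matrix.mulVec_mulVec] at h
    have h2 := congrArg (fun z => mat a *ᵥ z) h
    simpa only [mat_mulVec_inv] using h2.symm

section Point

variable {m : ℕ}

theorem pt_mk (g : G m) : pt (QuotientGroup.mk g : AdS m) = mat g *ᵥ baseVec m := rfl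

theorem pt_smul (g : G m) (p : AdS m) : pt (g • p) = mat g *ᵥ pt p := by
  induction p using QuotientGroup.induction_on with
  | H h =>
    change pt (QuotientGroup.mk (g * h) : AdS m) = _
    rw [pt_mk, pt_mk, mat_mul, Matrix.mulVec_mulVec]

theorem pt_injective : Function.Injective (pt : AdS m → Ix m → ℝ) := by
  intro p q
  induction p using QuotientGroup.induction_on with
  | H a =>
    induction q using QuotientGroup.induction_on with
    | H b =>
      intro h
      rw [pt_mk, pt_mk] at h
      refine QuotientGroup.eq.2 ?_
      change mat (a⁻¹ * b) *ᵥ baseVec m = baseVec m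
      rw [mat_mul, ← Matrix.mulVec_mulVec, ← h, mat_inv_mulVec]

theorem continuous_mat : Continuous (mat : G m → Matrix (Ix m) (Ix m) ℝ) :=
  (continuous_subtype_val (p := fun A : Matrix (Ix m) (Ix m) ℝ => A.det = 1)).comp
    ((continuous_subtype_val (p := fun g => g ∈ SO m)).comp
      (continuous_subtype_val (p := fun g => g ∈ G m)))

theorem continuous_pt : Continuous (pt : AdS m → Ix m → ℝ) :=
  Continuous.quotient_lift (Continuous.matrix_mulVec continuous_mat continuous_const) _

theorem ip_baseVec (x : Ix m → ℝ) : ip (baseVec m) x = x (Sum.inl 0) := ip_single_inl x 0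

theorem ip_pt (p : AdS m) : ip (pt p) (pt p) = 1 := by
  induction p using QuotientGroup.induction_on with
  | H a => rw [pt_mk, ip_mat, ip_baseVec]; simp [baseVec]

end Point

/-! ### Weight vectors and root vectors -/

section Weights

variable {m : ℕ}

/-- The basis vector `e_t`. -/
def vecT (m : ℕ) : Ix m → ℝ := Pi.single (Sum.inl 1) 1

/-- The basis vector `e_{x_1}`. -/
def vecX₁ (m : ℕ) : Ix m → ℝ := Pi.single (Sum.inr 0) 1

/-- The basis vector `e_{x_2}`. -/
def vecX₂ (m : ℕ) : Ix m → ℝ := Pi.single (Sum.inr 1) 1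

/-- The null vector `e_t + ε e_{x_1}`. -/
noncomputable def vecF (m : ℕ) (ε : ℝ) : Ix m → ℝ := vecT m + ε • vecX₁ m

/-- The null vector `e_u + ε e_{x_2}`. -/
noncomputable def vecH (m : ℕ) (ε : ℝ) : Ix m → ℝ := baseVec m + ε • vecX₂ m

theorem vec_ext {x y : Ix m → ℝ} (hu : x (Sum.inl 0) = y (Sum.inl 0))
    (ht : x (Sum.inl 1) = y (Sum.inl 1)) (h1 : x (Sum.inr 0) = y (Sum.inr 0))
    (h2 : x (Sum.inr 1) = y (Sum.inr 1))
    (h : ∀ j : Fin m, x (Sum.inr j.succ.succ) = y (Sum.inr j.succ.succ)) : x = y := by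
  ext i
  rcases i with i | i
  · fin_cases i
    exacts [hu, ht]
  · refine Fin.cases h1 (fun i => ?_) i
    exact Fin.cases h2 h i

@[simp]
theorem single_succ_succ (j : Fin m) :
    (Pi.single (Sum.inr 1) 1 : Ix m → ℝ) (Sum.inr j.succ.succ) = 0 :=
  Pi.single_eq_of_ne (by simp [Fin.ext_iff]) _

theorem J₁_mulVec (x : Ix m → ℝ) :
    (J₁ m : Matrix (Ix m) (Ix m) ℝ) *ᵥ x = x (Sum.inr 0) • vecT m + x (Sum.inl 1) • vecX₁ m := by
  simp [J₁, add_mulVec, single_mulVec, vecT, vecX₁, ← Pi.single_smul]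
  rfl

theorem J₂_mulVec (x : Ix m → ℝ) :
    (J₂ m : Matrix (Ix m) (Ix m) ℝ) *ᵥ x =
      x (Sum.inr 1) • baseVec m + x (Sum.inl 0) • vecX₂ m := by
  simp [J₂, add_mulVec, single_mulVec, baseVec, vecX₂, ← Pi.single_smul]
  rfl

theorem ip_vecF (ε : ℝ) (x : Ix m → ℝ) :
    ip (vecF m ε) x = x (Sum.inl 1) - ε * x (Sum.inr 0) := by
  rw [vecF, ip_add_left, ip_smul_left, vecT, vecX₁, ip_single_inl, ip_single_inr]
  ring

theorem ip_vecH (ε : ℝ) (x : Ix m → ℝ) :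
    ip (vecH m ε) x = x (Sum.inl 0) - ε * x (Sum.inr 1) := by
  rw [vecH, ip_add_left, ip_smul_left, vecX₂, ip_baseVec, ip_single_inr]
  ring

theorem J₁_vecF {ε : ℝ} (hε : ε * ε = 1) :
    (J₁ m : Matrix (Ix m) (Ix m) ℝ) *ᵥ vecF m ε = ε • vecF m ε := by
  rw [J₁_mulVec]
  apply vec_ext <;> simp [vecF, vecT, vecX₁, hε]

theorem J₂_vecF (ε : ℝ) : (J₂ m : Matrix (Ix m) (Ix m) ℝ) *ᵥ vecF m ε = 0 := by
  rw [J₂_mulVec]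
  apply vec_ext <;> simp [vecF, vecT, vecX₁, baseVec, vecX₂]

theorem J₁_vecH (ε : ℝ) : (J₁ m : Matrix (Ix m) (Ix m) ℝ) *ᵥ vecH m ε = 0 := by
  rw [J₁_mulVec]
  apply vec_ext <;> simp [vecH, vecT, vecX₁, baseVec, vecX₂]

theorem J₂_vecH {ε : ℝ} (hε : ε * ε = 1) :
    (J₂ m : Matrix (Ix m) (Ix m) ℝ) *ᵥ vecH m ε = ε • vecH m ε := by
  rw [J₂_mulVec]
  apply vec_ext <;> simp [vecH, baseVec, vecX₂, hε]

theorem eq_smul_vecF_of_J₁ {ε : ℝ} (hε : ε * ε = 1) {y : Ix m → ℝ}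
    (h : (J₁ m : Matrix (Ix m) (Ix m) ℝ) *ᵥ y = ε • y) : y = y (Sum.inl 1) • vecF m ε := by
  have h0 : ε ≠ 0 := by rintro rfl; simp at hε
  rw [J₁_mulVec] at h
  have h' := fun i => congrFun h i
  have hu := h' (Sum.inl 0)
  have h1 := h' (Sum.inr 0)
  have h2 := h' (Sum.inr 1)
  have h3 := fun j : Fin m => h' (Sum.inr j.succ.succ)
  simp [vecT, vecX₁, h0] at hu h1 h2 h3
  apply vec_ext
  · simp [vecF, vecT, vecX₁, hu]
  · simp [vecF, vecT, vecX₁]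
  · simp [vecF, vecT, vecX₁]
    linear_combination (-ε) * h1 - y (Sum.inr 0) * hε
  · simp [vecF, vecT, vecX₁, h2]
  · intro j
    simp [vecF, vecT, vecX₁, h3]

/-- The eigenvalues of `J₁` are `0` and `±1`, so `±2` is excluded. On the plane `(t, x_1)` the
square of `J₁` is the identity, whence `4 y = y` there; this is the source of the factor `1 / 3`. -/
theorem eq_zero_of_J₁ {a : ℝ} (h4 : a * a = 4) {y : Ix m → ℝ}
    (h : (J₁ m : Matrix (Ix m) (Ix m) ℝ) *ᵥ y = a • y) : y = 0 := by
  have h0 : a ≠ 0 := by rintro rfl; simp at h4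
  rw [J₁_mulVec] at h
  have h' := fun i => congrFun h i
  have hu := h' (Sum.inl 0)
  have ht := h' (Sum.inl 1)
  have h1 := h' (Sum.inr 0)
  have h2 := h' (Sum.inr 1)
  have h3 := fun j : Fin m => h' (Sum.inr j.succ.succ)
  simp [vecT, vecX₁, h0] at hu ht h1 h2 h3
  apply vec_ext
  · exact hu
  · simp only [Pi.zero_apply]
    linear_combination (-1 / 3 : ℝ) * (a * ht + h1 + y (Sum.inl 1) * h4)
  · simp only [Pi.zero_apply]
    linear_combination (-1 / 3 : ℝ) * (a * h1 + ht + y (Sum.inr 0) * h4)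
  · exact h2
  · exact h3

theorem eq_zero_of_J₂ {a : ℝ} (h4 : a * a = 4) {y : Ix m → ℝ}
    (h : (J₂ m : Matrix (Ix m) (Ix m) ℝ) *ᵥ y = a • y) : y = 0 := by
  have h0 : a ≠ 0 := by rintro rfl; simp at h4
  rw [J₂_mulVec] at h
  have h' := fun i => congrFun h i
  have hu := h' (Sum.inl 0)
  have ht := h' (Sum.inl 1)
  have h1 := h' (Sum.inr 0)
  have h2 := h' (Sum.inr 1)
  have h3 := fun j : Fin m => h' (Sum.inr j.succ.succ)
  simp [baseVec, vecX₂, h0] at hu ht h1 h2 h3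
  apply vec_ext
  · simp only [Pi.zero_apply]
    linear_combination (-1 / 3 : ℝ) * (a * hu + h2 + y (Sum.inl 0) * h4)
  · exact ht
  · exact h1
  · simp only [Pi.zero_apply]
    linear_combination (-1 / 3 : ℝ) * (a * h2 + hu + y (Sum.inr 1) * h4)
  · exact h3

/-! ### Root vectors and their action on the flag. -/

theorem mem_rootSpace {α β : ℝ} {X : so m} : X ∈ rootSpace m α β ↔
    (∀ x, (J₁ m).1 *ᵥ (X.1 *ᵥ x) = X.1 *ᵥ ((J₁ m).1 *ᵥ x) + α • (X.1 *ᵥ x)) ∧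
    ∀ x, (J₂ m).1 *ᵥ (X.1 *ᵥ x) = X.1 *ᵥ ((J₂ m).1 *ᵥ x) + β • (X.1 *ᵥ x) := by
  have key : ∀ (J : so m) (γ : ℝ), ⁅J, X⁆ = γ • X ↔
      ∀ x, J.1 *ᵥ (X.1 *ᵥ x) = X.1 *ᵥ (J.1 *ᵥ x) + γ • (X.1 *ᵥ x) := by
    intro J γ
    have h1 : ⁅J, X⁆ = γ • X ↔ J.1 * X.1 - X.1 * J.1 = γ • X.1 := by
      rw [Subtype.ext_iff]; rfl
    rw [h1, sub_eq_iff_eq_add']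
    constructor
    · intro h x
      rw [Matrix.mulVec_mulVec, h, add_mulVec, smul_mulVec, Matrix.mulVec_mulVec]
    · intro h
      refine mat_ext fun x => ?_
      rw [← Matrix.mulVec_mulVec, h, add_mulVec, smul_mulVec, Matrix.mulVec_mulVec]
  exact and_congr (key _ _) (key _ _)

theorem wedge_weight {J : so m} {a b : Ix m → ℝ} {α β : ℝ} (ha : J.1 *ᵥ a = α • a)
    (hb : J.1 *ᵥ b = β • b) (x : Ix m → ℝ) :
    J.1 *ᵥ ((wedge a b).1 *ᵥ x) = (wedge a b).1 *ᵥ (J.1 *ᵥ x) + (α + β) • ((wedge a b).1 *ᵥ x) := by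
  have h := mem_so_iff.1 J.2
  have h1 : ip a (J.1 *ᵥ x) = -α * ip a x := by
    rw [neg_mul, ← ip_smul_left, ← ha, h, neg_neg]
  have h2 : ip b (J.1 *ᵥ x) = -β * ip b x := by
    rw [neg_mul, ← ip_smul_left, ← hb, h, neg_neg]
  rw [wedge_mulVec, wedge_mulVec, mulVec_sub, mulVec_smul, mulVec_smul, ha, hb, h1, h2]
  module

/-- The nilpotent Lie algebra with roots `(ε, ε)`, `(ε, -ε)`, `(ε, 0)`, `(0, ε)`. -/
noncomputable def lieNSign (m : ℕ) (ε : ℝ) : Submodule ℝ (so m) :=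
  rootSpace m ε ε ⊔ rootSpace m ε (-ε) ⊔ rootSpace m ε 0 ⊔ rootSpace m 0 ε

/-- The group generated by `exp 𝒜` and `exp (lieNSign ε)`. -/
noncomputable def ANSign (m : ℕ) (ε : ℝ) : Subgroup (G m) :=
  expSubgroup (lieA m) ⊔ expSubgroup (lieNSign m ε)

theorem AN_eq : AN m = ANSign m 1 := rfl

theorem theta_theta (X : so m) : theta m (theta m X) = X := by
  ext i j
  simp [theta]

/-- `J₁` and `J₂` are symmetric matrices, so `θ` negates them and hence negates roots. This makes
the barred group the case `ε = -1` of `ANSign`. -/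
theorem theta_mem_rootSpace {α β : ℝ} {X : so m} (h : X ∈ rootSpace m α β) :
    theta m X ∈ rootSpace m (-α) (-β) := by
  have key : ∀ (J : so m) (γ : ℝ), J.1ᵀ = J.1 → ⁅J, X⁆ = γ • X → ⁅J, theta m X⁆ = -γ • theta m X := by
    intro J γ hJ h
    have h1 : J.1 * X.1 - X.1 * J.1 = γ • X.1 := congrArg Subtype.val h
    have h2 := congrArg transpose h1
    rw [transpose_sub, transpose_mul, transpose_mul, hJ, transpose_smul] at h2
    apply Subtype.ext
    change J.1 * (-X.1ᵀ) - -X.1ᵀ * J.1 = -γ • -X.1ᵀ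
    rw [neg_smul_neg, ← h2]
    noncomm_ring
  refine ⟨key _ _ ?_ h.1, key _ _ ?_ h.2⟩
  · simp [J₁, add_comm]
  · simp [J₂, add_comm]

theorem map_theta_rootSpace (α β : ℝ) :
    (rootSpace m α β).map (theta m) = rootSpace m (-α) (-β) := by
  ext X
  constructor
  · rintro ⟨Y, hY, rfl⟩
    exact theta_mem_rootSpace hY
  · intro hX
    exact ⟨theta m X, by simpa using theta_mem_rootSpace hX, theta_theta X⟩

theorem ANbar_eq : ANbar m = ANSign m (-1) := by
  have h : lieNbar m = lieNSign m (-1) := by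
    simp only [lieNbar, lieN, lieNSign, Submodule.map_sup, map_theta_rootSpace, neg_zero]
  rw [ANbar, ANSign, h]

/-- Weights add. The vectors `vecF` and `vecH` have weights `(ε, 0)` and `(0, ε)`. A root `(ε, β)`
would send `vecF` to `J₁`-weight `2ε`, which does not occur, and sends `vecH` to `J₁`-weight `ε`,
the line of `vecF`. The root `(0, ε)` would send `vecF` into its own line but with `J₂`-weight `ε`,
where `J₂` acts by `0`, and would send `vecH` to `J₂`-weight `2ε`. -/
theorem lieNSign_mulVec {ε : ℝ} (hε : ε * ε = 1) {X : so m} (hX : X ∈ lieNSign m ε) :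
    X.1 *ᵥ vecF m ε = 0 ∧ ∃ γ : ℝ, X.1 *ᵥ vecH m ε = γ • vecF m ε := by
  let V : Submodule ℝ (so m) :=
    { carrier := {X | X.1 *ᵥ vecF m ε = 0 ∧ ∃ γ : ℝ, X.1 *ᵥ vecH m ε = γ • vecF m ε}
      zero_mem' := ⟨by simp, 0, by simp⟩
      add_mem' := by
        rintro X Y ⟨h1, a, h2⟩ ⟨h3, b, h4⟩
        refine ⟨?_, a + b, ?_⟩
        · change (X.1 + Y.1) *ᵥ _ = 0
          rw [add_mulVec, h1, h3, add_zero]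
        · change (X.1 + Y.1) *ᵥ _ = _
          rw [add_mulVec, h2, h4, add_smul]
      smul_mem' := by
        rintro c X ⟨h1, a, h2⟩
        refine ⟨?_, c * a, ?_⟩
        · change (c • X.1) *ᵥ _ = 0
          rw [smul_mulVec, h1, smul_zero]
        · change (c • X.1) *ᵥ _ = _
          rw [smul_mulVec, h2, smul_smul] }
  have h4 : (ε + ε) * (ε + ε) = 4 := by linear_combination 4 * hε
  have hα : ∀ β, rootSpace m ε β ≤ V := by
    intro β X hX
    obtain ⟨h1, -⟩ := mem_rootSpace.1 hX
    refine ⟨eq_zero_of_J₁ h4 ?_, _, eq_smul_vecF_of_J₁ hε ?_⟩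
    · rw [h1, J₁_vecF hε, mulVec_smul, add_smul]
    · rw [h1, J₁_vecH, mulVec_zero, zero_add]
  have hβ : rootSpace m 0 ε ≤ V := by
    intro X hX
    obtain ⟨h1, h2⟩ := mem_rootSpace.1 hX
    refine ⟨?_, 0, ?_⟩
    · have h3 := eq_smul_vecF_of_J₁ hε (y := X.1 *ᵥ vecF m ε)
        (by rw [h1, J₁_vecF hε, mulVec_smul, zero_smul, add_zero])
      have h5 : ε • (X.1 *ᵥ vecF m ε) = 0 := by
        have h6 := h2 (vecF m ε)
        rw [J₂_vecF, mulVec_zero, zero_add] at h6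
        rw [← h6, h3, mulVec_smul, J₂_vecF, smul_zero]
      refine (smul_eq_zero.1 h5).resolve_left ?_
      rintro rfl
      simp at hε
    · rw [zero_smul]
      refine eq_zero_of_J₂ h4 ?_
      rw [h2, J₂_vecH hε, mulVec_smul, add_smul]
  exact (sup_le (sup_le (sup_le (hα _) (hα _)) (hα _)) hβ : lieNSign m ε ≤ V) hX

/-- `AN` acts on the flag `⟨f⟩ ⊂ ⟨f, h⟩` with positive diagonal coefficients. -/
theorem ANSign_mulVec {ε : ℝ} (hε : ε * ε = 1) {g : G m} (hg : g ∈ ANSign m ε) :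
    ∃ α β γ : ℝ, 0 < α ∧ 0 < β ∧ mat g *ᵥ vecF m ε = α • vecF m ε ∧
      mat g *ᵥ vecH m ε = β • vecH m ε + γ • vecF m ε := by
  -- The condition defines a subgroup, so it suffices to check it on the generating exponentials.
  let P : Subgroup (G m) :=
    { carrier := {g | ∃ α β γ : ℝ, 0 < α ∧ 0 < β ∧ mat g *ᵥ vecF m ε = α • vecF m ε ∧
        mat g *ᵥ vecH m ε = β • vecH m ε + γ • vecF m ε}
      one_mem' := ⟨1, 1, 0, one_pos, one_pos, by simp [mat_one], by simp [mat_one]⟩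
      mul_mem' := by
        rintro g k ⟨a, b, c, ha, hb, h1, h2⟩ ⟨a', b', c', ha', hb', h1', h2'⟩
        refine ⟨a * a', b * b', b' * c + c' * a, mul_pos ha ha', mul_pos hb hb', ?_, ?_⟩
        · rw [mat_mul, ← mulVec_mulVec, h1', mulVec_smul, h1]
          module
        · rw [mat_mul, ← mulVec_mulVec, h2', mulVec_add, mulVec_smul, mulVec_smul, h1, h2]
          module
      inv_mem' := by
        rintro g ⟨a, b, c, ha, hb, h1, h2⟩
        have h3 : mat g⁻¹ *ᵥ vecF m ε = a⁻¹ • vecF m ε := by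
          rw [eq_inv_smul_iff₀ ha.ne', ← mulVec_smul, ← h1, mat_inv_mulVec]
        refine ⟨a⁻¹, b⁻¹, -(b⁻¹ * (c * a⁻¹)), inv_pos.2 ha, inv_pos.2 hb, h3, ?_⟩
        have h4 := congrArg (fun z => mat g⁻¹ *ᵥ z) h2
        simp only [mat_inv_mulVec, mulVec_add, mulVec_smul, h3] at h4
        have h5 : mat g⁻¹ *ᵥ vecH m ε = b⁻¹ • (b • (mat g⁻¹ *ᵥ vecH m ε)) := by
          rw [inv_smul_smul₀ hb.ne']
        rw [h5, ← sub_eq_iff_eq_add.2 h4]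
        module }
  have hA : expSubgroup (lieA m) ≤ P := by
    refine (Subgroup.closure_le _).2 ?_
    rintro _ ⟨X, hX, rfl⟩
    obtain ⟨a, b, rfl⟩ := Submodule.mem_span_pair.1 hX
    refine ⟨_, _, 0, Real.exp_pos (a * ε), Real.exp_pos (b * ε), ?_, ?_⟩
    · rw [mat_expG]
      refine exp_mulVec_eigen ?_
      change (a • (J₁ m).1 + b • (J₂ m).1) *ᵥ _ = _
      rw [add_mulVec, smul_mulVec, smul_mulVec, J₁_vecF hε, J₂_vecF]
      module
    · rw [mat_expG, zero_smul, add_zero]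
      refine exp_mulVec_eigen ?_
      change (a • (J₁ m).1 + b • (J₂ m).1) *ᵥ _ = _
      rw [add_mulVec, smul_mulVec, smul_mulVec, J₁_vecH, J₂_vecH hε]
      module
  have hN : expSubgroup (lieNSign m ε) ≤ P := by
    refine (Subgroup.closure_le _).2 ?_
    rintro _ ⟨X, hX, rfl⟩
    obtain ⟨h1, γ, h2⟩ := lieNSign_mulVec hε hX
    refine ⟨1, 1, γ, one_pos, one_pos, ?_, ?_⟩
    · rw [mat_expG, exp_mulVec_of_sq (by rw [h1, mulVec_zero]), h1, one_smul, add_zero]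
    · rw [mat_expG, exp_mulVec_of_sq (by rw [h2, mulVec_smul, h1, smul_zero]), h2, one_smul]
  exact (sup_le hA hN : ANSign m ε ≤ P) hg

end Weights

/-! ### Normal forms under the Iwasawa groups -/

section NormalForm

variable {m : ℕ}

theorem mem_wedge_rootSpace {a b : Ix m → ℝ} {α β α' β' : ℝ}
    (h1 : (J₁ m).1 *ᵥ a = α • a) (h2 : (J₂ m).1 *ᵥ a = β • a)
    (h3 : (J₁ m).1 *ᵥ b = α' • b) (h4 : (J₂ m).1 *ᵥ b = β' • b) :
    wedge a b ∈ rootSpace m (α + α') (β + β') :=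
  mem_rootSpace.2 ⟨wedge_weight h1 h3, wedge_weight h2 h4⟩

theorem wedge_add_right (a b c : Ix m → ℝ) : wedge a (b + c) = wedge a b + wedge a c := by
  refine Subtype.ext (mat_ext fun x => ?_)
  change _ = ((wedge a b).1 + (wedge a c).1) *ᵥ x
  simp only [add_mulVec, wedge_mulVec, ip_add_left]
  module

theorem wedge_smul_right (a b : Ix m → ℝ) (c : ℝ) : wedge a (c • b) = c • wedge a b := by
  refine Subtype.ext (mat_ext fun x => ?_)
  change _ = (c • (wedge a b).1) *ᵥ x
  simp only [smul_mulVec, wedge_mulVec, ip_smul_left]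
  module

/-- The component of `v` orthogonal to `u`, `t`, `x_1`, `x_2`. -/
noncomputable def transverse (v : Ix m → ℝ) : Ix m → ℝ :=
  v - v (Sum.inl 0) • baseVec m - v (Sum.inl 1) • vecT m - v (Sum.inr 0) • vecX₁ m
    - v (Sum.inr 1) • vecX₂ m

theorem transverse_apply (v : Ix m → ℝ) : transverse v (Sum.inl 0) = 0 ∧
    transverse v (Sum.inl 1) = 0 ∧ transverse v (Sum.inr 0) = 0 ∧ transverse v (Sum.inr 1) = 0 := by
  simp [transverse, baseVec, vecT, vecX₁, vecX₂]

theorem J₁_eq_zero {v : Ix m → ℝ} (h1 : v (Sum.inl 1) = 0) (h2 : v (Sum.inr 0) = 0) :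
    (J₁ m).1 *ᵥ v = 0 := by
  rw [J₁_mulVec, h1, h2, zero_smul, zero_smul, add_zero]

theorem J₂_eq_zero {v : Ix m → ℝ} (h1 : v (Sum.inl 0) = 0) (h2 : v (Sum.inr 1) = 0) :
    (J₂ m).1 *ᵥ v = 0 := by
  rw [J₂_mulVec, h1, h2, zero_smul, zero_smul, add_zero]

theorem wedge_vecH_mem {ε : ℝ} (hε : ε * ε = 1) (v : Ix m → ℝ) :
    wedge (vecH m ε) (transverse v) ∈ lieNSign m ε := by
  obtain ⟨h1, h2, h3, h4⟩ := transverse_apply v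
  have h := mem_wedge_rootSpace (m := m) (α := 0) (β := ε) (α' := 0) (β' := 0)
    (by rw [J₁_vecH, zero_smul]) (J₂_vecH hε)
    (by rw [J₁_eq_zero h2 h3, zero_smul]) (by rw [J₂_eq_zero h1 h4, zero_smul])
  rw [add_zero, add_zero] at h
  exact Submodule.mem_sup_right h

/-- Such a `b` splits into multiples of `vecH ε` and `vecH (-ε)` and a transverse part; the three
wedges with `vecF` lie in the root spaces `(ε, ε)`, `(ε, -ε)` and `(ε, 0)`. -/
theorem wedge_vecF_mem {ε : ℝ} (hε : ε * ε = 1) {b : Ix m → ℝ} (ht : b (Sum.inl 1) = 0)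
    (h1 : b (Sum.inr 0) = 0) : wedge (vecF m ε) b ∈ lieNSign m ε := by
  have hb : b = ((b (Sum.inl 0) + ε * b (Sum.inr 1)) / 2) • vecH m ε +
      ((b (Sum.inl 0) - ε * b (Sum.inr 1)) / 2) • vecH m (-ε) + transverse b := by
    have h : b (Sum.inr 1) • vecX₂ m = (ε * ε * b (Sum.inr 1)) • vecX₂ m := by rw [hε, one_mul]
    rw [transverse, ht, h1, h, vecH, vecH]
    module
  have hJ : (J₁ m).1 *ᵥ vecF m ε = ε • vecF m ε := J₁_vecF hε
  have hJ' : (J₂ m).1 *ᵥ vecF m ε = (0 : ℝ) • vecF m ε := by rw [J₂_vecF, zero_smul]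
  have hJ0 : ∀ δ, (J₁ m).1 *ᵥ vecH m δ = (0 : ℝ) • vecH m δ := fun δ => by
    rw [J₁_vecH, zero_smul]
  obtain ⟨t1, t2, t3, t4⟩ := transverse_apply b
  have m1 := mem_wedge_rootSpace hJ hJ' (hJ0 ε) (J₂_vecH hε)
  have m2 := mem_wedge_rootSpace hJ hJ' (hJ0 (-ε)) (J₂_vecH (by rw [neg_mul_neg, hε]))
  have m3 := mem_wedge_rootSpace (α' := 0) (β' := 0) hJ hJ'
    (by rw [J₁_eq_zero t2 t3, zero_smul]) (by rw [J₂_eq_zero t1 t4, zero_smul])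
  simp only [add_zero, zero_add] at m1 m2 m3
  rw [hb, wedge_add_right, wedge_add_right, wedge_smul_right, wedge_smul_right]
  refine add_mem (add_mem (Submodule.smul_mem _ _ ?_) (Submodule.smul_mem _ _ ?_)) ?_
  · exact Submodule.mem_sup_left (Submodule.mem_sup_left (Submodule.mem_sup_left m1))
  · exact Submodule.mem_sup_left (Submodule.mem_sup_left (Submodule.mem_sup_right m2))
  · exact Submodule.mem_sup_left (Submodule.mem_sup_right m3)

theorem expG_mem_ANSign_of_lieA {ε : ℝ} {X : so m} (h : X ∈ lieA m) : expG X ∈ ANSign m ε :=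
  (le_sup_left : expSubgroup (lieA m) ≤ ANSign m ε) (Subgroup.subset_closure ⟨X, h, rfl⟩)

theorem expG_mem_ANSign_of_lieN {ε : ℝ} {X : so m} (h : X ∈ lieNSign m ε) :
    expG X ∈ ANSign m ε :=
  (le_sup_right : expSubgroup (lieNSign m ε) ≤ ANSign m ε) (Subgroup.subset_closure ⟨X, h, rfl⟩)

/-- The wedge maps everything into the span of `a` and `b`, sends `b` to a multiple of `a`, and
kills `a`, so its cube is zero and the exponential series stops at the quadratic term. -/
theorem exp_wedge_mulVec {a b : Ix m → ℝ} (haa : ip a a = 0) (hab : ip a b = 0) (v : Ix m → ℝ) :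
    mat (expG (wedge a b)) *ᵥ v =
      v + ip a v • b - (ip b v + 2⁻¹ * ip a v * ip b b) • a := by
  have h2 : (wedge a b).1 *ᵥ ((wedge a b).1 *ᵥ v) = -(ip a v * ip b b) • a := by
    simp only [wedge_mulVec, ip_sub_right, ip_smul_right, haa, hab, ip_comm b a]
    module
  have h3 : (wedge a b).1 *ᵥ ((wedge a b).1 *ᵥ ((wedge a b).1 *ᵥ v)) = 0 := by
    rw [h2, mulVec_smul, wedge_mulVec, haa, ip_comm b a, hab]
    simp
  rw [mat_expG, exp_mulVec_of_cube h3, h2, wedge_mulVec]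
  module

/-- The boost multiplies `f` by `r = 2σB` and `f'` by `r⁻¹`. This choice of `r`, together with `4AB
= 1`, makes both coefficients equal to `σ / 2`. -/
theorem exp_boost_mulVec {J : so m} {f f' : Ix m → ℝ} {ε σ A B : ℝ} (hε : ε * ε = 1)
    (hf : J.1 *ᵥ f = ε • f) (hf' : J.1 *ᵥ f' = (-ε) • f') (hAB : 4 * (A * B) = 1)
    (hσ : σ * σ = 1) (hB : 0 < σ * (2 * B)) :
    mat (expG ((ε * Real.log (σ * (2 * B))) • J)) *ᵥ (A • f + B • f') =
      (σ / 2) • (f + f') := by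
  set r := σ * (2 * B) with hr
  have e1 : ((ε * Real.log r) • J).1 *ᵥ f = Real.log r • f := by
    change ((ε * Real.log r) • J.1) *ᵥ f = _
    rw [smul_mulVec, hf, smul_smul]
    congr 1
    linear_combination Real.log r * hε
  have e2 : ((ε * Real.log r) • J).1 *ᵥ f' = (-Real.log r) • f' := by
    change ((ε * Real.log r) • J.1) *ᵥ f' = _
    rw [smul_mulVec, hf', smul_smul]
    congr 1
    linear_combination -Real.log r * hε
  rw [mat_expG, mulVec_add, mulVec_smul, mulVec_smul, exp_mulVec_eigen e1, exp_mulVec_eigen e2,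
    Real.exp_neg, Real.exp_log hB, smul_add, smul_smul, smul_smul]
  have hB0 : B ≠ 0 := by rintro rfl; simp at hAB
  have hσ0 : σ ≠ 0 := by rintro rfl; simp at hσ
  congr 2
  · rw [hr]
    linear_combination (σ / 2) * hAB
  · rw [hr]
    field_simp
    linear_combination -hσ

/-- The vector `σ e_t` represents the open orbits. -/
theorem exists_ANSign_eq_vecT {ε σ : ℝ} (hε : ε * ε = 1) (hσ : σ * σ = 1) {v : Ix m → ℝ}
    (hv : ip v v = 1) (hc : 0 < σ * ip (vecF m ε) v) :
    ∃ n ∈ ANSign m ε, mat n *ᵥ v = σ • vecT m := by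
  set c := ip (vecF m ε) v with hcdef
  have hc0 : c ≠ 0 := by rintro h; simp [h] at hc
  set w : Ix m → ℝ := v - v (Sum.inl 1) • vecT m - v (Sum.inr 0) • vecX₁ m with hw
  have hwt : w (Sum.inl 1) = 0 := by simp [hw, vecT, vecX₁]
  have hw1 : w (Sum.inr 0) = 0 := by simp [hw, vecT, vecX₁]
  -- The exponential of `wedge f b` adds `c • b = -w` to `v`, up to a multiple of `f`, and so leaves
  -- a vector of the plane `(t, x_1)`.
  set b := -c⁻¹ • w with hb
  have hbt : b (Sum.inl 1) = 0 := by simp [hb, hwt]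
  have hb1 : b (Sum.inr 0) = 0 := by simp [hb, hw1]
  have hff : ip (vecF m ε) (vecF m ε) = 0 := by
    rw [ip_vecF]; simp [vecF, vecT, vecX₁, hε]
  have hfb : ip (vecF m ε) b = 0 := by rw [ip_vecF, hbt, hb1]; ring
  have h1 := exp_wedge_mulVec hff hfb v
  obtain ⟨A, B, hy⟩ : ∃ A B : ℝ, mat (expG (wedge (vecF m ε) b)) *ᵥ v =
      A • vecF m ε + B • vecF m (-ε) := by
    refine ⟨(v (Sum.inl 1) + ε * v (Sum.inr 0)) / 2 - (ip b v + 2⁻¹ * ip (vecF m ε) v * ip b b),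
      (v (Sum.inl 1) - ε * v (Sum.inr 0)) / 2, ?_⟩
    rw [h1, ← hcdef]
    have h2 : v + c • b = v (Sum.inl 1) • vecT m + v (Sum.inr 0) • vecX₁ m := by
      rw [hb, smul_smul, mul_neg, mul_inv_cancel₀ hc0, hw]
      module
    rw [h2, vecF, vecF]
    have h3 : v (Sum.inr 0) • vecX₁ m = (ε * ε * v (Sum.inr 0)) • vecX₁ m := by rw [hε, one_mul]
    rw [h3]
    module
  have hBc : 2 * B = c := by
    have h4 : ip (vecF m ε) (mat (expG (wedge (vecF m ε) b)) *ᵥ v) = c := by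
      rw [h1, ip_sub_right, ip_add_right, ip_smul_right _ b, hfb, ip_smul_right, hff]
      ring
    rw [← h4, hy, ip_add_right, ip_smul_right, ip_smul_right, hff, ip_vecF]
    simp [vecF, vecT, vecX₁]
    linear_combination (-B) * hε
  have hAB : 4 * (A * B) = 1 := by
    have h4 := ip_mat (expG (wedge (vecF m ε) b)) v v
    rw [hv, hy] at h4
    have h5 : ip (vecF m (-ε)) (vecF m (-ε)) = 0 := by
      rw [ip_vecF]; simp [vecF, vecT, vecX₁, hε]
    have h6 : ip (vecF m ε) (vecF m (-ε)) = 2 := by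
      rw [ip_vecF]; simp [vecF, vecT, vecX₁, hε]; norm_num
    simp only [ip_add_left, ip_add_right, ip_smul_left, ip_smul_right, hff, h5, h6,
      ip_comm (vecF m (-ε)) (vecF m ε)] at h4
    linear_combination h4
  refine ⟨expG ((ε * Real.log (σ * (2 * B))) • J₁ m) * expG (wedge (vecF m ε) b),
    mul_mem (expG_mem_ANSign_of_lieA (Submodule.smul_mem _ _ (Submodule.subset_span (by simp))))
      (expG_mem_ANSign_of_lieN (wedge_vecF_mem hε hbt hb1)), ?_⟩
  rw [mat_mul, ← mulVec_mulVec, hy, exp_boost_mulVec hε (J₁_vecF hε)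
    (J₁_vecF (by rw [neg_mul_neg, hε])) hAB hσ (by rw [hBc]; exact hc), vecF, vecF]
  module

/-- The vector `σ e_u` represents the closed orbits. -/
theorem exists_ANSign_eq_baseVec {ε σ : ℝ} (hε : ε * ε = 1) (hσ : σ * σ = 1) {v : Ix m → ℝ}
    (hv : ip v v = 1) (hf : ip (vecF m ε) v = 0) (hd : 0 < σ * ip (vecH m ε) v) :
    ∃ n ∈ ANSign m ε, mat n *ᵥ v = σ • baseVec m := by
  set d := ip (vecH m ε) v with hddef
  have hd0 : d ≠ 0 := by rintro h; simp [h] at hd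
  have hff : ip (vecF m ε) (vecF m ε) = 0 := by
    rw [ip_vecF]; simp [vecF, vecT, vecX₁, hε]
  have hhh : ip (vecH m ε) (vecH m ε) = 0 := by
    rw [ip_vecH]; simp [vecH, baseVec, vecX₂, hε]
  have hfh : ip (vecF m ε) (vecH m ε) = 0 := by
    rw [ip_vecF]; simp [vecH, baseVec, vecX₂]
  have hh' : ip (vecH m ε) (vecH m (-ε)) = 2 := by
    rw [ip_vecH]; simp [vecH, baseVec, vecX₂, hε]; norm_num
  have h'' : ip (vecH m (-ε)) (vecH m (-ε)) = 0 := by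
    rw [ip_vecH]; simp [vecH, baseVec, vecX₂, hε]
  obtain ⟨t1, t2, t3, t4⟩ := transverse_apply (-d⁻¹ • v)
  -- Here `d • b` cancels the transverse part of `v`. Since `⟨f, v⟩ = 0`, the `(t, x_1)` part of `v`
  -- is a multiple of `f`, which `n₂` below removes.
  set b := transverse (-d⁻¹ • v) with hb
  have hhb : ip (vecH m ε) b = 0 := by rw [ip_vecH, t1, t4]; ring
  have h1 := exp_wedge_mulVec hhh hhb v
  obtain ⟨A, B, hy⟩ : ∃ A B : ℝ, mat (expG (wedge (vecH m ε) b)) *ᵥ v =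
      v (Sum.inl 1) • vecF m ε + (A • vecH m ε + B • vecH m (-ε)) := by
    refine ⟨(v (Sum.inl 0) + ε * v (Sum.inr 1)) / 2 - (ip b v + 2⁻¹ * ip (vecH m ε) v * ip b b),
      (v (Sum.inl 0) - ε * v (Sum.inr 1)) / 2, ?_⟩
    rw [h1, ← hddef]
    have h2 : d • b = -transverse v := by
      rw [hb, transverse, transverse]
      simp only [Pi.smul_apply, smul_eq_mul]
      have : d * d⁻¹ = 1 := mul_inv_cancel₀ hd0
      simp only [smul_sub, smul_smul, mul_neg, neg_mul, ← mul_assoc, this]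
      module
    have h3 : v (Sum.inr 1) • vecX₂ m = (ε * ε * v (Sum.inr 1)) • vecX₂ m := by rw [hε, one_mul]
    have h4 : v (Sum.inr 0) = ε * v (Sum.inl 1) := by
      rw [ip_vecF] at hf
      linear_combination (-ε) * hf - v (Sum.inr 0) * hε
    rw [h2, transverse, h3, h4, vecF, vecH, vecH]
    module
  set n₁ := expG (wedge (vecH m ε) b) with hn₁
  have hfy : ip (vecF m ε) (mat n₁ *ᵥ v) = 0 := by
    rw [h1, ip_sub_right, ip_add_right, ip_smul_right, ip_smul_right, hf, hfh, ip_vecF, t2, t3]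
    ring
  have hhy : ip (vecH m ε) (mat n₁ *ᵥ v) = d := by
    rw [h1, ip_sub_right, ip_add_right, ip_smul_right, ip_smul_right, hhh, hhb]
    ring
  set n₂ := expG (wedge (vecF m ε) ((v (Sum.inl 1) / d) • vecH m ε)) with hn₂
  have hy2 : mat n₂ *ᵥ (mat n₁ *ᵥ v) = A • vecH m ε + B • vecH m (-ε) := by
    rw [hn₂, exp_wedge_mulVec hff (by rw [ip_smul_right, hfh, mul_zero]), hfy, ip_smul_left, hhy,
      div_mul_cancel₀ _ hd0, hy]
    module
  have hBd : 2 * B = d := by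
    rw [← hhy, hy, ip_add_right, ip_add_right, ip_smul_right, ip_smul_right, ip_smul_right, hhh,
      hh', ip_comm, hfh]
    ring
  have hAB : 4 * (A * B) = 1 := by
    have h4 := ip_mat n₂ (mat n₁ *ᵥ v) (mat n₁ *ᵥ v)
    rw [hy2, ip_mat, hv] at h4
    simp only [ip_add_left, ip_add_right, ip_smul_left, ip_smul_right, hhh, h'', hh',
      ip_comm (vecH m (-ε)) (vecH m ε)] at h4
    linear_combination h4
  refine ⟨expG ((ε * Real.log (σ * (2 * B))) • J₂ m) * (n₂ * n₁),
    mul_mem (expG_mem_ANSign_of_lieA (Submodule.smul_mem _ _ (Submodule.subset_span (by simp))))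
      (mul_mem (expG_mem_ANSign_of_lieN (wedge_vecF_mem hε ?_ ?_))
        (expG_mem_ANSign_of_lieN (wedge_vecH_mem hε _))), ?_⟩
  · simp [vecH, baseVec, vecX₂]
  · simp [vecH, baseVec, vecX₂]
  rw [mat_mul, ← mulVec_mulVec, mat_mul, ← mulVec_mulVec, hy2, exp_boost_mulVec hε (J₂_vecH hε)
    (J₂_vecH (by rw [neg_mul_neg, hε])) hAB hσ (by rw [hBd]; exact hd), vecH, vecH]
  module

/-- If both products vanished, the contributions of `(t, x_1)` and of `(u, x_2)` to `⟨v, v⟩` would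
cancel, leaving minus a sum of squares instead of `1`. -/
theorem ip_vecH_ne_zero {ε : ℝ} (hε : ε * ε = 1) {v : Ix m → ℝ}
    (hv : ip v v = 1) (hf : ip (vecF m ε) v = 0) : ip (vecH m ε) v ≠ 0 := by
  intro hh
  rw [ip_vecF] at hf
  rw [ip_vecH] at hh
  rw [ip_eq, Fin.sum_univ_succ, Fin.sum_univ_succ] at hv
  have h0 : 0 ≤ ∑ i : Fin m, v (Sum.inr i.succ.succ) * v (Sum.inr i.succ.succ) :=
    Finset.sum_nonneg fun _ _ => mul_self_nonneg _
  have h1 : v (Sum.inl 1) * v (Sum.inl 1) = v (Sum.inr 0) * v (Sum.inr 0) := by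
    rw [sub_eq_zero.1 hf]
    linear_combination v (Sum.inr 0) * v (Sum.inr 0) * hε
  have h2 : v (Sum.inl 0) * v (Sum.inl 0) = v (Sum.inr 1) * v (Sum.inr 1) := by
    rw [sub_eq_zero.1 hh]
    linear_combination v (Sum.inr 1) * v (Sum.inr 1) * hε
  have h3 : (Fin.succ 0 : Fin (m + 2)) = 1 := rfl
  rw [h3] at hv
  linarith

/-! ### The singularity in coordinates -/

theorem mem_orbit_ANSign {ε : ℝ} {p q : AdS m} :
    q ∈ MulAction.orbit (ANSign m ε) p ↔ ∃ n ∈ ANSign m ε, mat n *ᵥ pt p = pt q := by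
  constructor
  · rintro ⟨⟨n, hn⟩, rfl⟩
    exact ⟨n, hn, (pt_smul n p).symm⟩
  · rintro ⟨n, hn, h⟩
    exact ⟨⟨n, hn⟩, pt_injective ((pt_smul n p).trans h)⟩

theorem mem_orbit_of_eq {ε : ℝ} {p q : AdS m} {w : Ix m → ℝ}
    (hp : ∃ n ∈ ANSign m ε, mat n *ᵥ pt p = w) (hq : ∃ n ∈ ANSign m ε, mat n *ᵥ pt q = w) :
    q ∈ MulAction.orbit (ANSign m ε) p := by
  obtain ⟨n, hn, h⟩ := hp
  obtain ⟨n', hn', h'⟩ := hq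
  refine mem_orbit_ANSign.2 ⟨n'⁻¹ * n, mul_mem (inv_mem hn') hn, ?_⟩
  rw [mat_mul, ← mulVec_mulVec, h, ← h', mat_inv_mulVec]

theorem continuous_ip {X : Type*} [TopologicalSpace X] {f g : X → Ix m → ℝ} (hf : Continuous f)
    (hg : Continuous g) : Continuous fun x => ip (f x) (g x) := by
  have h1 : ∀ i, Continuous fun x => f x i := fun i => (continuous_apply i).comp hf
  have h2 : ∀ i, Continuous fun x => g x i := fun i => (continuous_apply i).comp hg
  simp only [ip_eq]
  exact (((h1 _).mul (h2 _)).add ((h1 _).mul (h2 _))).sub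
    (continuous_finsetSum _ fun i _ => (h1 _).mul (h2 _))

theorem continuous_expG_smul (X : so m) : Continuous fun s : ℝ => expG (s • X) := by
  suffices h : Continuous fun s : ℝ => expSO (s • X) from h.subtype_mk _
  refine Continuous.subtype_mk (Continuous.subtype_mk ?_ _) _
  let : NormedRing (Matrix (Ix m) (Ix m) ℝ) := Matrix.linftyOpNormedRing
  let : NormedAlgebra ℝ (Matrix (Ix m) (Ix m) ℝ) := Matrix.linftyOpNormedAlgebra
  let : NormedAlgebra ℚ (Matrix (Ix m) (Ix m) ℝ) := NormedAlgebra.restrictScalars ℚ ℝ _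
  have : Continuous fun s : ℝ => s • (X : Matrix (Ix m) (Ix m) ℝ) := by fun_prop
  exact NormedSpace.exp_continuous.comp this

/-- The geodesics in the null directions are straight lines of the quadric. -/
theorem exp_wedge_baseVec {k : Ix m → ℝ} (hu : k (Sum.inl 0) = 0) (hk : ip k k = 0) (s : ℝ) :
    mat (expG (s • wedge (baseVec m) k)) *ᵥ baseVec m = baseVec m + s • k := by
  have hb : (wedge (baseVec m) k).1 *ᵥ baseVec m = k := by
    rw [wedge_mulVec, ip_comm k, ip_baseVec, ip_baseVec, hu]
    simp [baseVec]
  have hkk : (wedge (baseVec m) k).1 *ᵥ k = 0 := by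
    rw [wedge_mulVec, ip_baseVec, hk, hu]
    simp
  have h1 : (s • wedge (baseVec m) k).1 *ᵥ baseVec m = s • k := by
    change (s • (wedge (baseVec m) k).1) *ᵥ _ = _
    rw [smul_mulVec, hb]
  have h2 : (s • wedge (baseVec m) k).1 *ᵥ (s • k) = 0 := by
    change (s • (wedge (baseVec m) k).1) *ᵥ _ = _
    rw [smul_mulVec, mulVec_smul, hkk, smul_zero, smul_zero]
  rw [mat_expG, exp_mulVec_of_sq (by rw [h1, h2]), h1]

theorem exists_sign {c : ℝ} (hc : c ≠ 0) : ∃ σ : ℝ, σ * σ = 1 ∧ 0 < σ * c := by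
  rcases hc.lt_or_gt with h | h
  · exact ⟨-1, by norm_num, by linarith⟩
  · exact ⟨1, by norm_num, by linarith⟩

theorem isClosed_orbit_ANSign {ε : ℝ} (hε : ε * ε = 1) (p : AdS m) :
    IsClosed (MulAction.orbit (ANSign m ε) p) ↔ ip (vecF m ε) (pt p) = 0 := by
  have hinv : ∀ q ∈ MulAction.orbit (ANSign m ε) p, ∃ α β γ : ℝ, 0 < α ∧ 0 < β ∧
      ip (vecF m ε) (pt q) = α * ip (vecF m ε) (pt p) ∧
      ip (vecH m ε) (pt q) = β * ip (vecH m ε) (pt p) + γ * ip (vecF m ε) (pt p) := by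
    intro q hq
    obtain ⟨n, hn, h⟩ := mem_orbit_ANSign.1 hq
    obtain ⟨α, β, γ, hα, hβ, h1, h2⟩ := ANSign_mulVec hε (inv_mem hn)
    have key : ∀ x, ip x (pt q) = ip (mat n⁻¹ *ᵥ x) (pt p) := fun x => by
      rw [← h, ← ip_mat n⁻¹, mat_inv_mulVec]
    refine ⟨α, β, γ, hα, hβ, ?_, ?_⟩
    · rw [key, h1, ip_smul_left]
    · rw [key, h2, ip_add_left, ip_smul_left, ip_smul_left]
  constructor
  · intro hcl
    by_contra hc
    obtain ⟨σ, hσ, hσc⟩ := exists_sign hc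
    -- The line `e_u + s k` stays in the quadric because `k` is null and orthogonal to `e_u`. For `s
    -- > 0` it has the same sign of `⟨f, ·⟩` as `p` and so lies in the orbit of `p`; at `s = 0` it
    -- leaves the orbit, which is therefore not closed.
    set k : Ix m → ℝ := σ • vecT m + vecX₂ m with hk
    have hku : k (Sum.inl 0) = 0 := by simp [hk, vecT, vecX₂]
    have hkk : ip k k = 0 := by
      have h1 : ip (vecT m) k = σ := by
        rw [vecT, ip_single_inl]; simp [hk, vecT, vecX₂]
      have h2 : ip (vecX₂ m) k = -1 := by
        rw [vecX₂, ip_single_inr]; simp [hk, vecT, vecX₂]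
      conv_lhs => rw [hk, ip_add_left, ip_smul_left, ← hk, h1, h2]
      linear_combination hσ
    let q : ℝ → AdS m := fun s => QuotientGroup.mk (expG (s • wedge (baseVec m) k))
    have hq : ∀ s, pt (q s) = baseVec m + s • k := fun s => by
      rw [pt_mk, exp_wedge_baseVec hku hkk]
    have hqf : ∀ s, ip (vecF m ε) (pt (q s)) = s * σ := fun s => by
      rw [hq, ip_vecF]; simp [hk, baseVec, vecT, vecX₂]
    have hqc : Continuous q :=
      QuotientGroup.continuous_mk.comp (continuous_expG_smul _)
    have hmem : ∀ s : ℝ, 0 < s → q s ∈ MulAction.orbit (ANSign m ε) p := fun s hs =>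
      mem_orbit_of_eq (exists_ANSign_eq_vecT hε hσ (ip_pt p) hσc)
        (exists_ANSign_eq_vecT hε hσ (ip_pt _) (by
          rw [hqf]
          have : σ * (s * σ) = s := by linear_combination s * hσ
          rwa [this]))
    have h0 : q 0 ∈ MulAction.orbit (ANSign m ε) p :=
      hcl.mem_of_tendsto (b := nhdsWithin (0 : ℝ) (Set.Ioi 0))
        (hqc.continuousAt.mono_left nhdsWithin_le_nhds)
        (Filter.eventually_of_mem self_mem_nhdsWithin hmem)
    obtain ⟨α, -, -, hα, -, h1, -⟩ := hinv _ h0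
    rw [hqf, zero_mul] at h1
    exact (mul_ne_zero hα.ne' hc) h1.symm
  · intro hf
    obtain ⟨σ, hσ, hσd⟩ := exists_sign (ip_vecH_ne_zero hε (ip_pt p) hf)
    -- The weak inequality makes the set visibly closed. It is equivalent to the strict one because
    -- `⟨h, ·⟩` never vanishes where `⟨f, ·⟩` does.
    have horb : MulAction.orbit (ANSign m ε) p =
        {q | ip (vecF m ε) (pt q) = 0 ∧ 0 ≤ σ * ip (vecH m ε) (pt q)} := by
      ext q
      constructor
      · intro hq
        obtain ⟨α, β, γ, -, hβ, h1, h2⟩ := hinv q hq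
        rw [hf, mul_zero] at h1
        rw [hf, mul_zero, add_zero] at h2
        refine ⟨h1, ?_⟩
        rw [h2, mul_left_comm]
        exact (mul_pos hβ hσd).le
      · rintro ⟨h1, h2⟩
        have h3 : 0 < σ * ip (vecH m ε) (pt q) := by
          refine lt_of_le_of_ne h2 (mul_ne_zero ?_ (ip_vecH_ne_zero hε (ip_pt q) h1)).symm
          rintro rfl
          simp at hσ
        exact mem_orbit_of_eq (exists_ANSign_eq_baseVec hε hσ (ip_pt p) hf hσd)
          (exists_ANSign_eq_baseVec hε hσ (ip_pt q) h1 h3)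
    rw [horb]
    exact (isClosed_eq (continuous_ip continuous_const continuous_pt) continuous_const).inter
      (isClosed_le continuous_const
        (continuous_const.mul (continuous_ip continuous_const continuous_pt)))

theorem mem_singularity {p : AdS m} : p ∈ singularity m ↔
    pt p (Sum.inl 1) - pt p (Sum.inr 0) = 0 ∨ pt p (Sum.inl 1) + pt p (Sum.inr 0) = 0 := by
  rw [singularity, AN_eq, ANbar_eq, Set.mem_union, Set.mem_ofPred_eq, Set.mem_ofPred_eq,
    isClosed_orbit_ANSign (by norm_num), isClosed_orbit_ANSign (by norm_num), ip_vecF, ip_vecF]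
  simp

end NormalForm

/-! ### Light-like directions -/

section Directions

variable {m : ℕ}

theorem sigmaMat_mulVec (x : Ix m → ℝ) :
    sigmaMat m *ᵥ x = x - (2 * x (Sum.inl 0)) • baseVec m := by
  ext i
  rw [sigmaMat, mulVec_diagonal]
  by_cases h : i = Sum.inl 0
  · subst h
    simp [baseVec]
    ring
  · simp [baseVec, h]

theorem mulVec_baseVec (M : Matrix (Ix m) (Ix m) ℝ) (i : Ix m) :
    (M *ᵥ baseVec m) i = M i (Sum.inl 0) := by
  rw [baseVec, mulVec_single_one]
  rfl

theorem isFutureLightlike_wedge {k : Ix m → ℝ} (hu : k (Sum.inl 0) = 0) (hk : ip k k = 0)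
    (ht : 0 < k (Sum.inl 1)) : IsFutureLightlike (wedge (baseVec m) k) := by
  have hb : (baseVec m) (Sum.inl 0) = 1 := by simp [baseVec]
  have hkb : ip k (baseVec m) = 0 := by rw [ip_comm, ip_baseVec, hu]
  refine ⟨mat_ext fun x => ?_, ⟨3, mat_ext fun x => ?_⟩, ?_⟩
  · rw [← mulVec_mulVec, ← mulVec_mulVec, neg_mulVec]
    simp only [sigmaMat_mulVec, wedge_mulVec, ip_baseVec, ip_sub_right, ip_smul_right, hkb,
      Pi.sub_apply, Pi.smul_apply, smul_eq_mul, hu, hb]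
    module
  · rw [pow_succ, pow_two, ← mulVec_mulVec, ← mulVec_mulVec, zero_mulVec]
    simp only [wedge_mulVec, ip_baseVec, ip_sub_right, ip_smul_right, hk, hu, hb, hkb]
    module
  · have h := congrFun (wedge_mulVec (baseVec m) k (baseVec m)) (Sum.inl 1)
    rw [ip_baseVec, hkb, hb, one_smul, zero_smul, sub_zero, mulVec_baseVec] at h
    rwa [h]

/-- An element of `𝒬` is determined by `k = E e_u`, which is orthogonal to `e_u`. Then `E ^ 2`
multiplies `e_u` by `-⟨k, k⟩`, so nilpotency forces `k` to be null. -/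
theorem IsFutureLightlike.exists_eq_wedge {E : so m} (hE : IsFutureLightlike E) :
    ∃ k : Ix m → ℝ, k (Sum.inl 0) = 0 ∧ ip k k = 0 ∧ 0 < k (Sum.inl 1) ∧
      E = wedge (baseVec m) k := by
  obtain ⟨hQ, hN, hpos⟩ := hE
  have hb : (baseVec m) (Sum.inl 0) = 1 := by simp [baseVec]
  have hS : ∀ x, sigmaMat m *ᵥ (E.1 *ᵥ (sigmaMat m *ᵥ x)) = -(E.1 *ᵥ x) := fun x => by
    rw [mulVec_mulVec, mulVec_mulVec, hQ, neg_mulVec]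
  set k := E.1 *ᵥ baseVec m with hk
  have hu : k (Sum.inl 0) = 0 := by
    have h := congrFun (hS (baseVec m)) (Sum.inl 0)
    simp only [sigmaMat_mulVec, mulVec_sub, mulVec_smul, hb, ← hk, Pi.sub_apply, Pi.smul_apply,
      smul_eq_mul, Pi.neg_apply] at h
    have hsk := mem_so_iff.1 E.2 (baseVec m) (baseVec m)
    rw [← hk, ip_baseVec, ip_comm, ip_baseVec] at hsk
    linarith
  have hEw : E = wedge (baseVec m) k := by
    refine Subtype.ext (mat_ext fun x => ?_)
    rw [wedge_mulVec, ip_baseVec]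
    set y := x - x (Sum.inl 0) • baseVec m with hy
    have hyu : y (Sum.inl 0) = 0 := by simp [hy, hb]
    have hSy : sigmaMat m *ᵥ y = y := by rw [sigmaMat_mulVec, hyu]; simp
    have h1 := hS y
    rw [hSy, sigmaMat_mulVec] at h1
    have h2 : (E.1 *ᵥ y) (Sum.inl 0) = -ip k x := by
      have hsk := mem_so_iff.1 E.2 (baseVec m) y
      rw [← hk, ip_baseVec, hy, ip_sub_right, ip_smul_right, ip_comm k (baseVec m), ip_baseVec,
        hu] at hsk
      rw [hy]
      linarith
    rw [h2] at h1
    have h3 : E.1 *ᵥ y = -ip k x • baseVec m := by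
      have h4 : (2 : ℝ) • (E.1 *ᵥ y) = (2 : ℝ) • (-ip k x • baseVec m) := by
        rw [two_smul]
        nth_rewrite 1 [← sub_add_cancel (E.1 *ᵥ y) ((2 * -ip k x) • baseVec m)]
        rw [h1]
        module
      exact smul_right_injective _ two_ne_zero h4
    have h5 : x = x (Sum.inl 0) • baseVec m + y := by rw [hy]; module
    conv_lhs => rw [h5, mulVec_add, mulVec_smul, ← hk, h3]
    module
  refine ⟨k, hu, ?_, ?_, hEw⟩
  · obtain ⟨n, hn⟩ := hN
    have h1 : (E.1 ^ 2) *ᵥ baseVec m = (-ip k k) • baseVec m := by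
      rw [pow_two, ← mulVec_mulVec, ← hk, hEw, wedge_mulVec, ip_baseVec, hu]
      module
    have h2 := pow_mulVec_eigen h1 n
    rw [← pow_mul, mul_comm, pow_mul, hn, zero_pow two_ne_zero, zero_mulVec] at h2
    have h3 := congrFun h2 (Sum.inl 0)
    rw [Pi.smul_apply, hb, Pi.zero_apply, smul_eq_mul, mul_one] at h3
    exact neg_eq_zero.1 (eq_zero_of_pow_eq_zero h3.symm)
  · rw [hk, mulVec_baseVec]
    exact hpos

/-- The vectors at which the invariants of the closed orbits vanish. -/
def IsSing (v : Ix m → ℝ) : Prop :=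
  v (Sum.inl 1) - v (Sum.inr 0) = 0 ∨ v (Sum.inl 1) + v (Sum.inr 0) = 0

theorem geodesic_wedge_mem {k : Ix m → ℝ} (hu : k (Sum.inl 0) = 0) (hk : ip k k = 0) (g : G m)
    (s : ℝ) : geodesic g (wedge (baseVec m) k) s ∈ singularity m ↔
      IsSing (mat g *ᵥ (baseVec m + s • k)) := by
  rw [mem_singularity, geodesic, pt_mk, mat_mul, ← mulVec_mulVec, exp_wedge_baseVec hu hk]
  rfl

/-! ### Time orientation and independence of the representative. -/

theorem sum_mul_sq_le (x y : Ix m → ℝ) : (∑ j, x (Sum.inr j) * y (Sum.inr j)) ^ 2 ≤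
    (∑ j, x (Sum.inr j) * x (Sum.inr j)) * ∑ j, y (Sum.inr j) * y (Sum.inr j) := by
  have h := Finset.sum_mul_sq_le_sq_mul_sq Finset.univ (fun j => x (Sum.inr j : Ix m))
    fun j => y (Sum.inr j)
  simpa only [pow_two] using h

/-- Time orientation is detected by the product with a future vector. -/
theorem future_of_ip_pos {z y : Ix m → ℝ} (hzu : z (Sum.inl 0) = 0) (hyu : y (Sum.inl 0) = 0)
    (hz : 0 < z (Sum.inl 1)) (hzz : 0 ≤ ip z z) (hyy : 0 ≤ ip y y) (hzy : 0 < ip z y) :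
    0 < y (Sum.inl 1) := by
  by_contra! h
  have hcs := sum_mul_sq_le z y
  rw [ip_eq, hzu] at hzz hzy
  rw [ip_eq, hyu] at hyy
  set a := ∑ j, z (Sum.inr j) * y (Sum.inr j)
  set b := ∑ j, z (Sum.inr j) * z (Sum.inr j)
  set c := ∑ j, y (Sum.inr j) * y (Sum.inr j) with hc
  have hc0 : 0 ≤ c := Finset.sum_nonneg fun _ _ => mul_self_nonneg _
  have h1 : b * c ≤ (z (Sum.inl 1) * z (Sum.inl 1)) * (y (Sum.inl 1) * y (Sum.inl 1)) :=
    mul_le_mul (by linarith) (by linarith) hc0 (mul_self_nonneg _)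
  -- Now `a < z_t y_t ≤ 0` gives `a ^ 2 > (z_t y_t) ^ 2 ≥ b c`, against Cauchy–Schwarz.
  have h2 : z (Sum.inl 1) * y (Sum.inl 1) ≤ 0 := mul_nonpos_of_nonneg_of_nonpos hz.le h
  have h3 : a < z (Sum.inl 1) * y (Sum.inl 1) := by linarith
  nlinarith

theorem continuous_SO_apply (i j : Ix m) : Continuous fun g : SO m => g.1.1 i j :=
  (continuous_apply j).comp ((continuous_apply i).comp
    ((continuous_subtype_val (p := fun A : Matrix (Ix m) (Ix m) ℝ => A.det = 1)).comp
      (continuous_subtype_val (p := fun g => g ∈ SO m))))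

/-- On the identity component the block of the positive directions has positive determinant. -/
theorem block_det_pos (g : G m) : 0 < mat g (Sum.inl 0) (Sum.inl 0) * mat g (Sum.inl 1) (Sum.inl 1) -
    mat g (Sum.inl 0) (Sum.inl 1) * mat g (Sum.inl 1) (Sum.inl 0) := by
  let φ : SO m → ℝ := fun g => g.1.1 (Sum.inl 0) (Sum.inl 0) * g.1.1 (Sum.inl 1) (Sum.inl 1) -
    g.1.1 (Sum.inl 0) (Sum.inl 1) * g.1.1 (Sum.inl 1) (Sum.inl 0)
  have hφ : Continuous φ :=
    ((continuous_SO_apply _ _).mul (continuous_SO_apply _ _)).sub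
      ((continuous_SO_apply _ _).mul (continuous_SO_apply _ _))
  have hne : ∀ g, φ g ≠ 0 := by
    intro g h0
    have hg := isometry_iff.1 g.2
    have h1 := hg (Pi.single (Sum.inl 0) 1) (Pi.single (Sum.inl 0) 1)
    have h2 := hg (Pi.single (Sum.inl 1) 1) (Pi.single (Sum.inl 1) 1)
    have h3 := hg (Pi.single (Sum.inl 0) 1) (Pi.single (Sum.inl 1) 1)
    rw [ip_single_inl] at h1 h2 h3
    have hcs := sum_mul_sq_le (g.1.1 *ᵥ Pi.single (Sum.inl 0) 1) (g.1.1 *ᵥ Pi.single (Sum.inl 1) 1)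
    rw [ip_eq] at h1 h2 h3
    set S₁ := ∑ j, (g.1.1 *ᵥ Pi.single (Sum.inl 0) 1) (Sum.inr j) *
      (g.1.1 *ᵥ Pi.single (Sum.inl 0) 1) (Sum.inr j) with hS₁
    set S₂ := ∑ j, (g.1.1 *ᵥ Pi.single (Sum.inl 1) 1) (Sum.inr j) *
      (g.1.1 *ᵥ Pi.single (Sum.inl 1) 1) (Sum.inr j) with hS₂
    set S₃ := ∑ j, (g.1.1 *ᵥ Pi.single (Sum.inl 0) 1) (Sum.inr j) *
      (g.1.1 *ᵥ Pi.single (Sum.inl 1) 1) (Sum.inr j)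
    have hp₁ : 0 ≤ S₁ := Finset.sum_nonneg fun _ _ => mul_self_nonneg _
    have hp₂ : 0 ≤ S₂ := Finset.sum_nonneg fun _ _ => mul_self_nonneg _
    simp at h1 h2 h3
    change g.1.1 (Sum.inl 0) (Sum.inl 0) * g.1.1 (Sum.inl 1) (Sum.inl 1) -
      g.1.1 (Sum.inl 0) (Sum.inl 1) * g.1.1 (Sum.inl 1) (Sum.inl 0) = 0 at h0
    set a := g.1.1 (Sum.inl 0) (Sum.inl 0)
    set b := g.1.1 (Sum.inl 0) (Sum.inl 1)
    set c := g.1.1 (Sum.inl 1) (Sum.inl 0)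
    set d := g.1.1 (Sum.inl 1) (Sum.inl 1)
    -- The squared determinant is the Gram determinant of the positive parts of the two columns. By
    -- Cauchy–Schwarz it is at least `1`, so the block determinant never vanishes and keeps its sign
    -- on the identity component.
    have e : (a * d - b * c) ^ 2 = (1 + S₁) * (1 + S₂) - S₃ ^ 2 := by
      have e1 : a * a + c * c = 1 + S₁ := by linarith
      have e2 : b * b + d * d = 1 + S₂ := by linarith
      have e3 : a * b + c * d = S₃ := by linarith
      rw [← e1, ← e2, ← e3]
      ring
    rw [h0] at e
    nlinarith
  by_contra! hle
  have hpc : IsPreconnected (connectedComponent (1 : SO m)) := isPreconnected_connectedComponent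
  have h1 : φ 1 = 1 := by simp [φ]
  obtain ⟨k, -, hk⟩ := hpc.intermediate_value g.2 mem_connectedComponent hφ.continuousOn
    (show (0 : ℝ) ∈ Set.Icc (φ g.1) (φ 1) from ⟨hle, by rw [h1]; exact zero_le_one⟩)
  exact hne k hk

theorem mem_H_iff {g : G m} : g ∈ H m ↔ mat g *ᵥ baseVec m = baseVec m := Iff.rfl

/-- As `h` fixes `e_u`, the positive block determinant reduces to the entry `h t t`. Thus `h e_t` is
future, and `h k` has positive product with it. -/
theorem future_of_mem_H {h : G m} (hh : h ∈ H m) {k : Ix m → ℝ} (hu : k (Sum.inl 0) = 0)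
    (hk : ip k k = 0) (ht : 0 < k (Sum.inl 1)) :
    (mat h *ᵥ k) (Sum.inl 0) = 0 ∧ 0 < (mat h *ᵥ k) (Sum.inl 1) := by
  have hfix : ∀ x, (mat h *ᵥ x) (Sum.inl 0) = x (Sum.inl 0) := fun x => by
    rw [← ip_baseVec (mat h *ᵥ x), ← mem_H_iff.1 hh, ip_mat, ip_baseVec]
  have hcol : ∀ i, mat h i (Sum.inl 0) = baseVec m i := fun i => by
    rw [← mulVec_baseVec (mat h) i, mem_H_iff.1 hh]
  have hdet := block_det_pos h
  rw [hcol, hcol] at hdet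
  simp [baseVec] at hdet
  refine ⟨(hfix k).trans hu, future_of_ip_pos (z := mat h *ᵥ vecT m) ?_ ((hfix k).trans hu) ?_ ?_ ?_
    ?_⟩
  · rw [hfix]; simp [vecT]
  · rw [vecT, mulVec_single_one]
    exact hdet
  · rw [ip_mat, vecT, ip_single_inl]; simp
  · rw [ip_mat, hk]
  · rw [ip_mat, vecT, ip_single_inl]; exact ht

/-- The free part in coordinates, with respect to any representative. -/
theorem mk_mem_freePart {g : G m} : (QuotientGroup.mk g : AdS m) ∈ freePart m ↔
    ∃ k : Ix m → ℝ, k (Sum.inl 0) = 0 ∧ ip k k = 0 ∧ 0 < k (Sum.inl 1) ∧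
      ∀ s : ℝ, 0 < s → ¬IsSing (mat g *ᵥ (baseVec m + s • k)) := by
  constructor
  · rintro ⟨g', hg, E, hE, hs⟩
    obtain ⟨k, hu, hk, ht, rfl⟩ := hE.exists_eq_wedge
    -- Passing from `g'` to `g` transforms `k` by this element of `H`, which fixes `e_u` and
    -- preserves future null directions.
    have hh : g⁻¹ * g' ∈ H m := QuotientGroup.eq.1 hg.symm
    obtain ⟨h1, h2⟩ := future_of_mem_H hh hu hk ht
    refine ⟨mat (g⁻¹ * g') *ᵥ k, h1, by rw [ip_mat, hk], h2, fun s hs0 => ?_⟩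
    have h3 := hs s hs0
    rw [geodesic_wedge_mem hu hk] at h3
    convert h3 using 2
    nth_rewrite 1 [← mem_H_iff.1 hh]
    rw [← mulVec_smul, ← mulVec_add, mulVec_mulVec, ← mat_mul, mul_inv_cancel_left]
  · rintro ⟨k, hu, hk, ht, hs⟩
    exact ⟨g, rfl, _, isFutureLightlike_wedge hu hk ht, fun s hs0 => by
      rw [geodesic_wedge_mem hu hk]; exact hs s hs0⟩

theorem blackHole_eq : blackHole m = (freePart m)ᶜ := by
  ext p
  simp only [blackHole, freePart, Set.mem_compl_iff, Set.mem_ofPred_eq]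
  push Not
  rfl

end Directions

/-! ### The inclusion in coordinates -/

section Inclusion

variable {m : ℕ}

/-- The vector `(x, c)`. -/
def extend (x : Ix m → ℝ) (c : ℝ) : Ix (m + 1) → ℝ :=
  Sum.elim (fun i => x (Sum.inl i)) (Fin.snoc (α := fun _ => ℝ) (fun j => x (Sum.inr j)) c)

theorem extend_inl (x : Ix m → ℝ) (c : ℝ) (i : Fin 2) :
    extend x c (Sum.inl i) = x (Sum.inl i) := rfl

theorem extend_castSucc (x : Ix m → ℝ) (c : ℝ) (j : Fin (m + 2)) :
    extend x c (Sum.inr j.castSucc) = x (Sum.inr j) := by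
  simp [extend]

theorem extend_last (x : Ix m → ℝ) (c : ℝ) :
    extend x c (Sum.inr (Fin.last (m + 2))) = c := by
  simp [extend]

theorem extend_zero (x : Ix m → ℝ) (c : ℝ) : extend x c (Sum.inr 0) = x (Sum.inr 0) :=
  extend_castSucc x c 0

theorem extend_ext {x y : Ix (m + 1) → ℝ} (h : ∀ i, x (Sum.inl i) = y (Sum.inl i))
    (h' : ∀ j : Fin (m + 2), x (Sum.inr j.castSucc) = y (Sum.inr j.castSucc))
    (h'' : x (Sum.inr (Fin.last (m + 2))) = y (Sum.inr (Fin.last (m + 2)))) : x = y := by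
  ext i
  rcases i with i | i
  · exact h i
  · exact Fin.lastCases h'' h' i

theorem exists_eq_extend (y : Ix (m + 1) → ℝ) : ∃ x c, y = extend (m := m) x c :=
  ⟨Sum.elim (fun i => y (Sum.inl i)) fun j => y (Sum.inr j.castSucc),
    y (Sum.inr (Fin.last (m + 2))),
    extend_ext (fun _ => rfl) (fun _ => by rw [extend_castSucc]; rfl) (by rw [extend_last])⟩

theorem extend_add (x y : Ix m → ℝ) (c d : ℝ) :
    extend x c + extend y d = extend (x + y) (c + d) :=
  extend_ext (fun _ => rfl) (fun _ => by simp [extend_castSucc]) (by simp [extend_last])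

theorem smul_extend (x : Ix m → ℝ) (s c : ℝ) : s • extend x c = extend (s • x) (s * c) :=
  extend_ext (fun _ => rfl) (fun _ => by simp [extend_castSucc]) (by simp [extend_last])

theorem ip_extend (x y : Ix m → ℝ) (c d : ℝ) :
    ip (extend x c) (extend y d) = ip x y - c * d := by
  rw [ip_eq, ip_eq, Fin.sum_univ_castSucc]
  simp only [extend_inl, extend_castSucc, extend_last]
  ring

theorem extend_eq (x : Ix m → ℝ) (c : ℝ) :
    extend x c = Sum.elim x (fun _ => c) ∘ (ixEquiv m).symm := by
  rw [Equiv.eq_comp_symm]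
  ext i
  rcases i with (i | i) | i
  · rfl
  · simpa [ixEquiv, Fin.castSucc] using extend_castSucc x c i
  · have h : ixEquiv m (Sum.inr i) = Sum.inr (Fin.last (m + 2)) := by
      rw [Subsingleton.elim i 0]; rfl
    change extend x c (ixEquiv m (Sum.inr i)) = c
    rw [h, extend_last]

theorem embMat_mulVec (M : Matrix (Ix m) (Ix m) ℝ) (x : Ix m → ℝ) (c : ℝ) :
    embMat M *ᵥ extend x c = extend (M *ᵥ x) c := by
  rw [extend_eq, extend_eq, embMat, Matrix.reindex_apply, Matrix.submatrix_mulVec_equiv]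
  simp [Function.comp_assoc, Matrix.fromBlocks_mulVec]

theorem mat_embG (g : G m) : mat (embG m g) = embMat (mat g) := rfl

theorem extend_baseVec : extend (baseVec m) 0 = baseVec (m + 1) :=
  extend_ext (fun i => by simp [extend_inl, baseVec, Pi.single_apply])
    (fun i => by simp [extend_castSucc, baseVec]) (by simp [extend_last, baseVec])

theorem iota_mk (g : G m) : iota m (QuotientGroup.mk g) = QuotientGroup.mk (embG m g) := rfl

theorem pt_iota (p : AdS m) : pt (iota m p) = extend (pt p) 0 := by
  induction p using QuotientGroup.induction_on with
  | H g => rw [iota_mk, pt_mk, pt_mk, mat_embG, ← extend_baseVec, embMat_mulVec]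

theorem isSing_extend {x : Ix m → ℝ} {c : ℝ} : IsSing (extend x c) ↔ IsSing x := by
  rw [IsSing, IsSing, extend_inl, extend_zero]

theorem iota_mem_singularity {p : AdS m} : iota m p ∈ singularity (m + 1) ↔ p ∈ singularity m := by
  rw [mem_singularity, mem_singularity, pt_iota, extend_inl, extend_zero]

/-- A future time-like direction which escapes the singularity can be replaced by a light-like
one. -/
theorem exists_lightlike {g : G m} {k : Ix m → ℝ} {c : ℝ} (hu : k (Sum.inl 0) = 0)
    (hc : c ≠ 0) (hk : ip k k = c * c) (ht : 0 < k (Sum.inl 1))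
    (hs : ∀ s : ℝ, 0 < s → ¬IsSing (mat g *ᵥ (baseVec m + s • k))) :
    (QuotientGroup.mk g : AdS m) ∈ freePart m := by
  set v := mat g *ᵥ baseVec m with hv
  set τ := v (Sum.inr 1) with hτ
  -- The sign is chosen so that `μ = l σ τ ≥ 0` below, which keeps the reparametrisation `s / (1 + s
  -- μ)` defined and positive for all `s > 0`.
  obtain ⟨σ, hσ, hστ⟩ : ∃ σ : ℝ, σ * σ = 1 ∧ 0 ≤ σ * τ := by
    rcases le_total 0 τ with h | h
    · exact ⟨1, by norm_num, by linarith⟩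
    · exact ⟨-1, by norm_num, by linarith⟩
  set e := mat g⁻¹ *ᵥ vecX₂ m with he
  have hge : mat g *ᵥ e = vecX₂ m := mat_mulVec_inv g _
  have heu : e (Sum.inl 0) = -τ := by
    rw [← ip_baseVec e, ← ip_mat g, hge, ip_comm, vecX₂, ip_single_inr]
  have hee : ip e e = -1 := by
    rw [← ip_mat g, hge, vecX₂, ip_single_inr]; simp
  -- The image `g r = σ (τ v + e_{x_2})` changes `t` and `x_1` only through a multiple of the point
  -- `v` itself. The term `τ e_u` makes `r` orthogonal to `e_u`.
  set r := σ • (τ • baseVec m + e) with hr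
  have hru : r (Sum.inl 0) = 0 := by simp [hr, heu, baseVec]
  have hrr : ip r r = -(1 + τ * τ) := by
    simp only [hr, ip_add_left, ip_add_right, ip_smul_left, ip_smul_right, hee, ip_baseVec,
      ip_comm e (baseVec m), heu]
    simp [baseVec]
    linear_combination (-(1 + τ * τ)) * hσ
  have hgr : mat g *ᵥ r = (σ * τ) • v + σ • vecX₂ m := by
    rw [hr, mulVec_smul, mulVec_add, mulVec_smul, hge, smul_add, smul_smul]
  set D := 1 + τ * τ with hD
  have hD0 : 0 < D := by nlinarith [mul_self_nonneg τ]
  set B := ip k r with hB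
  have hc2 : 0 < c * c := mul_self_pos.2 hc
  have hdisc : 0 ≤ B * B + D * (c * c) := add_nonneg (mul_self_nonneg B) (mul_pos hD0 hc2).le
  set q := √(B * B + D * (c * c)) with hq
  have hqq : q * q = B * B + D * (c * c) := Real.mul_self_sqrt hdisc
  have hq0 : 0 ≤ q := Real.sqrt_nonneg _
  have hl0 : 0 ≤ (B + q) / D := by
    refine div_nonneg ?_ hD0.le
    nlinarith [mul_pos hD0 hc2]
  -- This is the equation `⟨k + l r, k + l r⟩ = 0`. The product of its roots is negative, and the
  -- nonnegative root is taken.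
  obtain ⟨l, hl, hroot⟩ : ∃ l : ℝ, 0 ≤ l ∧ c * c + 2 * l * B - l * l * D = 0 := by
    refine ⟨(B + q) / D, hl0, ?_⟩
    field_simp
    linear_combination -hqq
  have hkr : ip (k + l • r) (k + l • r) = 0 := by
    simp only [ip_add_left, ip_add_right, ip_smul_left, ip_smul_right, ip_comm r k, hk, hrr, ← hB]
    linear_combination hroot
  have hkru : (k + l • r) (Sum.inl 0) = 0 := by simp [hu, hru]
  refine mk_mem_freePart.2 ⟨k + l • r, hkru, hkr, ?_, ?_⟩
  · refine future_of_ip_pos hu hkru ht (by rw [hk]; exact hc2.le) hkr.ge ?_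
    rw [ip_add_right, ip_smul_right, hk, ← hB]
    nlinarith [mul_nonneg (mul_self_nonneg l) hD0.le]
  · intro s hs0
    set μ := l * (σ * τ) with hμ
    have hμ0 : 0 ≤ μ := mul_nonneg hl hστ
    have h1 : 0 < 1 + s * μ := by positivity
    have h2 := hs (s / (1 + s * μ)) (div_pos hs0 h1)
    -- Apart from `x_2`, the new geodesic at `s` is a positive multiple of the old line at `s / (1 +
    -- s μ)`, and `IsSing` is invariant under scaling.
    have key : ∀ i, vecX₂ m i = 0 → (mat g *ᵥ (baseVec m + s • (k + l • r))) i =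
        (1 + s * μ) * (mat g *ᵥ (baseVec m + (s / (1 + s * μ)) • k)) i := by
      intro i hi
      simp only [mulVec_add, mulVec_smul, ← hv, hgr, Pi.add_apply, Pi.smul_apply, smul_eq_mul, hi]
      have hν : s / (1 + s * μ) * (1 + s * μ) = s := div_mul_cancel₀ _ h1.ne'
      linear_combination (-(mat g *ᵥ k) i) * hν - s * v i * hμ
    rw [IsSing, key _ (by simp [vecX₂]), key _ (by simp [vecX₂]), ← mul_sub, ← mul_add,
      mul_eq_zero_iff_left h1.ne', mul_eq_zero_iff_left h1.ne']
    exact h2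

/-- The last component `c` of a direction plays no role in `IsSing`. Downstairs the direction is
null if `c = 0` and time-like otherwise, the latter case being `exists_lightlike`. -/
theorem iota_mem_freePart {p : AdS m} : iota m p ∈ freePart (m + 1) ↔ p ∈ freePart m := by
  induction p using QuotientGroup.induction_on with
  | H g =>
    have key : ∀ (s : ℝ) (k : Ix m → ℝ) (c : ℝ),
        IsSing (mat (embG m g) *ᵥ (baseVec (m + 1) + s • extend k c)) ↔
          IsSing (mat g *ᵥ (baseVec m + s • k)) := fun s k c => by
      rw [← extend_baseVec, smul_extend, extend_add, mat_embG, embMat_mulVec, isSing_extend]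
    rw [iota_mk]
    constructor
    · intro h
      obtain ⟨k', hu, hk, ht, hs⟩ := mk_mem_freePart.1 h
      obtain ⟨k, c, rfl⟩ := exists_eq_extend k'
      simp only [key] at hs
      rw [ip_extend, sub_eq_zero] at hk
      by_cases hc : c = 0
      · rw [hc, mul_zero] at hk
        exact mk_mem_freePart.2 ⟨k, hu, hk, ht, hs⟩
      · exact exists_lightlike hu hc hk ht hs
    · intro h
      obtain ⟨k, hu, hk, ht, hs⟩ := mk_mem_freePart.1 h
      refine mk_mem_freePart.2 ⟨extend k 0, hu, ?_, ht, fun s hs0 => ?_⟩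
      · rw [ip_extend, hk, mul_zero, sub_zero]
      · rw [key]; exact hs s hs0

theorem iota_mem_blackHole {p : AdS m} : iota m p ∈ blackHole (m + 1) ↔ p ∈ blackHole m := by
  rw [blackHole_eq, blackHole_eq, Set.mem_compl_iff, Set.mem_compl_iff, iota_mem_freePart]

end Inclusion

/-! ### Reflections and local sections of `G → G / H` -/

section Reflections

variable {m : ℕ}

/-- The reflection in the hyperplane orthogonal to `a`. -/
noncomputable def reflMat (a : Ix m → ℝ) : Matrix (Ix m) (Ix m) ℝ :=
  1 + vecMulVec (-(2 / ip a a) • a) (eta m *ᵥ a)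

theorem reflMat_mulVec (a x : Ix m → ℝ) :
    reflMat a *ᵥ x = x - (2 / ip a a * ip a x) • a := by
  rw [reflMat, add_mulVec, one_mulVec, vecMulVec_eta_mulVec]
  module

theorem det_reflMat {a : Ix m → ℝ} (ha : ip a a ≠ 0) : (reflMat a).det = -1 := by
  have h : (eta m *ᵥ a) ⬝ᵥ a = ip a a := by rw [ip, dotProduct_comm]
  rw [reflMat, vecMulVec_eq Unit, det_one_add_replicateCol_mul_replicateRow, dotProduct_smul, h,
    smul_eq_mul, neg_mul, div_mul_cancel₀ _ ha]
  norm_num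

theorem ip_reflMat {a : Ix m → ℝ} (ha : ip a a ≠ 0) (x y : Ix m → ℝ) :
    ip (reflMat a *ᵥ x) (reflMat a *ᵥ y) = ip x y := by
  simp only [reflMat_mulVec, ip_sub_left, ip_sub_right, ip_smul_left, ip_smul_right, ip_comm x a]
  field_simp
  ring

theorem reflMat_mul_self {a : Ix m → ℝ} (ha : ip a a ≠ 0) : reflMat a * reflMat a = 1 := by
  refine mat_ext fun x => ?_
  have h : 2 / ip a a * ip a (reflMat a *ᵥ x) = -(2 / ip a a * ip a x) := by
    rw [reflMat_mulVec, ip_sub_right, ip_smul_right]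
    field_simp
    ring
  rw [← mulVec_mulVec, reflMat_mulVec a (reflMat a *ᵥ x), h, reflMat_mulVec, one_mulVec]
  module

theorem continuous_reflMat {X : Type*} [TopologicalSpace X] {f : X → Ix m → ℝ} (hf : Continuous f)
    (h0 : ∀ x, ip (f x) (f x) ≠ 0) : Continuous fun x => reflMat (f x) := by
  refine continuous_const.add (Continuous.matrix_vecMulVec ?_
    (Continuous.matrix_mulVec continuous_const hf))
  exact (continuous_const.div (continuous_ip hf hf) h0).neg.smul hf

/-- The vectors of positive square on the same side as `b`. -/
def posCone (b : Ix m → ℝ) : Set (Ix m → ℝ) := {a | 0 < ip a a ∧ 0 < ip b a}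

theorem isOpen_posCone (b : Ix m → ℝ) : IsOpen (posCone b) :=
  (isOpen_lt continuous_const (continuous_ip continuous_id continuous_id)).inter
    (isOpen_lt continuous_const (continuous_ip continuous_const continuous_id))

/-- The set is star-shaped about `b`: the square of `s b + t a` is a sum of nonnegative terms,
because `⟨b, a⟩ > 0`. -/
theorem isPreconnected_posCone {b : Ix m → ℝ} (hb : 0 < ip b b) : IsPreconnected (posCone b) := by
  have h : StarConvex ℝ b (posCone b) := by
    rintro a ⟨h1, h2⟩ s t hs ht hst
    rw [posCone, Set.mem_ofPred_eq]
    simp only [ip_add_left, ip_add_right, ip_smul_left, ip_smul_right, ip_comm a b]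
    rcases hs.eq_or_lt with rfl | hs
    · obtain rfl : t = 1 := by linarith
      constructor <;> linarith
    · constructor <;> positivity
  exact (h.isPathConnected ⟨hb, hb⟩).isConnected.isPreconnected

/-- The product of the reflections defined by `a` and `b`. -/
noncomputable def reflPair {b : Ix m → ℝ} (hb : 0 < ip b b) (a : posCone b) : SO m :=
  ⟨⟨reflMat a * reflMat b, by
    rw [det_mul, det_reflMat a.2.1.ne', det_reflMat hb.ne']; norm_num⟩,
    isometry_iff.2 fun x y => by
      simp only [← mulVec_mulVec, ip_reflMat a.2.1.ne', ip_reflMat hb.ne']⟩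

theorem continuous_reflPair {b : Ix m → ℝ} (hb : 0 < ip b b) : Continuous (reflPair hb) := by
  refine Continuous.subtype_mk (Continuous.subtype_mk ?_ _) _
  exact (continuous_reflMat continuous_subtype_val fun a => a.2.1.ne').mul continuous_const

/-- Two reflections have determinant `1`, and moving `a` to `b` inside the connected cone deforms
the product to the identity. -/
theorem reflPair_mem {b : Ix m → ℝ} (hb : 0 < ip b b) (a : posCone b) : reflPair hb a ∈ G m := by
  have : PreconnectedSpace (posCone b) := Subtype.preconnectedSpace (isPreconnected_posCone hb)
  have h1 : reflPair hb ⟨b, hb, hb⟩ = 1 :=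
    Subtype.ext (Subtype.ext (reflMat_mul_self hb.ne'))
  exact (isPreconnected_range (continuous_reflPair hb)).subset_connectedComponent ⟨_, h1⟩ ⟨a, rfl⟩

/-- The map `pt` is open onto the quadric. -/
theorem eventually_exists_pt_eq {p : AdS m} {U : Set (AdS m)} (hU : U ∈ nhds p) :
    ∀ᶠ v in nhds (pt p), ip v v = 1 → ∃ q ∈ U, pt q = v := by
  set b := pt p with hbdef
  have hb1 : ip b b = 1 := ip_pt p
  have hb : 0 < ip b b := by rw [hb1]; exact one_pos
  let F : posCone b → AdS m := fun a => (⟨reflPair hb a, reflPair_mem hb a⟩ : G m) • p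
  have hF : Continuous F :=
    ((continuous_reflPair hb).subtype_mk (reflPair_mem hb)).smul continuous_const
  have hptF : ∀ a, pt (F a) = reflMat a.1 *ᵥ (reflMat b *ᵥ b) := fun a => by
    rw [pt_smul, mulVec_mulVec]
    rfl
  have hF0 : F ⟨b, hb, hb⟩ = p := by
    refine pt_injective ?_
    rw [hptF, mulVec_mulVec, reflMat_mul_self hb.ne', one_mulVec]
  have h1 : F ⁻¹' U ∈ nhds (⟨b, hb, hb⟩ : posCone b) :=
    hF.continuousAt.preimage_mem_nhds (by rwa [hF0])
  have h2 : Subtype.val '' (F ⁻¹' U) ∈ nhds b := by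
    have := Filter.image_mem_map (m := Subtype.val) h1
    rwa [(isOpen_posCone b).isOpenEmbedding_subtypeVal.map_nhds_eq] at this
  -- The reflection in `b` sends `b` to `-b`, and the reflection in the midpoint `(v + b) / 2` sends
  -- `-b` to `v`. The midpoint tends to `b` as `v` does, so the corresponding translate of `p` stays
  -- in `U`.
  have hc : Continuous fun v : Ix m → ℝ => (2⁻¹ : ℝ) • (v + b) := by fun_prop
  have h3 : Filter.Tendsto (fun v : Ix m → ℝ => (2⁻¹ : ℝ) • (v + b)) (nhds b) (nhds b) := by
    have h4 : (2⁻¹ : ℝ) • (b + b) = b := by module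
    simpa only [h4] using hc.tendsto b
  filter_upwards [h3 h2] with v hv hv1
  obtain ⟨a, haU, ha⟩ := hv
  refine ⟨F a, haU, ?_⟩
  have ha0 : ip a.1 a.1 ≠ 0 := a.2.1.ne'
  have hbb : reflMat b *ᵥ b = -b := by
    rw [reflMat_mulVec, hb1]
    module
  have hab : ip a.1 b = ip a.1 a.1 := by
    simp only [ha, ip_add_left, ip_add_right, ip_smul_left, ip_smul_right, hb1, hv1, ip_comm b v]
    ring
  rw [hptF, hbb, reflMat_mulVec, ip_neg_right, hab, mul_neg, div_mul_cancel₀ _ ha0, ha]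
  module

end Reflections

/-! ### Rotations in the plane of the last two coordinates -/

section Rotations

variable {m : ℕ}

/-- The last but one coordinate index of `AdS (m + 1)`. -/
abbrev idxA (m : ℕ) : Fin (m + 3) := (Fin.last (m + 1)).castSucc

/-- The last coordinate index of `AdS (m + 1)`. -/
abbrev idxB (m : ℕ) : Fin (m + 3) := Fin.last (m + 2)

/-- The rotation of angle `θ` in the plane of the last two coordinates. -/
noncomputable def lastRotation (m : ℕ) (θ : ℝ) : G (m + 1) :=
  expG (θ • wedge (Pi.single (Sum.inr (idxA m)) 1) (Pi.single (Sum.inr (idxB m)) 1))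

theorem lastRotation_mulVec (θ : ℝ) (x : Ix (m + 1) → ℝ) :
    mat (lastRotation m θ) *ᵥ x = x +
      ((Real.cos θ - 1) * x (Sum.inr (idxA m)) + Real.sin θ * x (Sum.inr (idxB m))) •
        Pi.single (Sum.inr (idxA m)) 1 +
      ((Real.cos θ - 1) * x (Sum.inr (idxB m)) - Real.sin θ * x (Sum.inr (idxA m))) •
        Pi.single (Sum.inr (idxB m)) 1 := by
  have hne : idxA m ≠ idxB m := (Fin.castSucc_lt_last _).ne
  set a : Ix (m + 1) → ℝ := Pi.single (Sum.inr (idxA m)) 1 with ha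
  set b : Ix (m + 1) → ℝ := Pi.single (Sum.inr (idxB m)) 1 with hb
  set X := wedge a b with hX
  have hXx : ∀ y, X.1 *ᵥ y = y (Sum.inr (idxB m)) • a - y (Sum.inr (idxA m)) • b := fun y => by
    rw [hX, wedge_mulVec, ha, hb, ip_single_inr, ip_single_inr]
    module
  have haa : a (Sum.inr (idxA m)) = 1 := by simp [ha]
  have hab : a (Sum.inr (idxB m)) = 0 := by simp [ha, hne.symm]
  have hba : b (Sum.inr (idxA m)) = 0 := by simp [hb, hne]
  have hbb : b (Sum.inr (idxB m)) = 1 := by simp [hb]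
  have hXa : X.1 *ᵥ a = -b := by rw [hXx, haa, hab]; module
  have hXb : X.1 *ᵥ b = a := by rw [hXx, hba, hbb]; module
  have e1 := exp_mulVec_rotation (X := X.1) (v := a) (by rw [hXa, mulVec_neg, hXb]) θ
  have e2 := exp_mulVec_rotation (X := X.1) (v := b) (by rw [hXb, hXa]) θ
  set y := x - x (Sum.inr (idxA m)) • a - x (Sum.inr (idxB m)) • b with hy
  have hXy : (θ • X.1) *ᵥ y = (0 : ℝ) • y := by
    rw [smul_mulVec, hXx]
    simp [hy, haa, hab, hba, hbb]
  have e3 := exp_mulVec_eigen hXy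
  have hx : x = y + x (Sum.inr (idxA m)) • a + x (Sum.inr (idxB m)) • b := by rw [hy]; module
  have hm : mat (lastRotation m θ) = NormedSpace.exp (θ • X.1) := rfl
  conv_lhs => rw [hm, hx, mulVec_add, mulVec_add, mulVec_smul, mulVec_smul, e1, e2, e3, hXa, hXb]
  rw [Real.exp_zero, hy]
  module

/-- `x_1` has index `0`, while the rotated coordinates have indices `m + 1` and `m + 2`. This is a
place where `l ≥ 3` matters. -/
theorem lastRotation_isSing (θ : ℝ) (x : Ix (m + 1) → ℝ) :
    IsSing (mat (lastRotation m θ) *ᵥ x) ↔ IsSing x := by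
  have h1 : (0 : Fin (m + 3)) ≠ idxA m := by simp [Fin.ext_iff]
  have h2 : (0 : Fin (m + 3)) ≠ idxB m := by simp [Fin.ext_iff]
  rw [IsSing, IsSing, lastRotation_mulVec]
  simp [h1, h2]

/-- The projection of `ℝ^{2,l}` to `ℝ^{2,l-1}` which rotates the last two coordinates to one. -/
noncomputable def foldLast (σ : ℝ) (v : Ix (m + 1) → ℝ) : Ix m → ℝ :=
  Sum.elim (fun i => v (Sum.inl i)) (Fin.snoc (α := fun _ => ℝ)
    (fun j : Fin (m + 1) => v (Sum.inr j.castSucc.castSucc))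
    (σ * ‖(⟨v (Sum.inr (idxA m)), v (Sum.inr (idxB m))⟩ : ℂ)‖))

theorem continuous_foldLast (σ : ℝ) : Continuous (foldLast (m := m) σ) := by
  refine continuous_pi fun i => ?_
  rcases i with i | i
  · exact continuous_apply _
  · refine Fin.lastCases ?_ (fun j => ?_) i
    · simp only [foldLast, Sum.elim_inr, Fin.snoc_last, Complex.norm_def, Complex.normSq_apply]
      fun_prop
    · simp only [foldLast, Sum.elim_inr, Fin.snoc_castSucc]
      exact continuous_apply _

/-- The norm forgets the sign of the last coordinate, and `σ` restores it. Fixing `σ` from `x` alone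
leaves a single continuous map to use near `extend x 0`. -/
theorem foldLast_extend (x : Ix m → ℝ) : ∃ σ : ℝ, σ * σ = 1 ∧ foldLast σ (extend x 0) = x := by
  obtain ⟨σ, hσ, h⟩ : ∃ σ : ℝ, σ * σ = 1 ∧
      σ * |x (Sum.inr (Fin.last (m + 1)))| = x (Sum.inr (Fin.last (m + 1))) := by
    rcases le_total 0 (x (Sum.inr (Fin.last (m + 1)))) with h | h
    · exact ⟨1, by norm_num, by rw [abs_of_nonneg h, one_mul]⟩
    · exact ⟨-1, by norm_num, by rw [abs_of_nonpos h]; ring⟩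
  refine ⟨σ, hσ, ?_⟩
  ext i
  rcases i with i | i
  · rfl
  · refine Fin.lastCases ?_ (fun j => ?_) i
    · rw [foldLast, Sum.elim_inr, Fin.snoc_last, extend_castSucc, extend_last]
      have h2 : ‖(⟨x (Sum.inr (Fin.last (m + 1))), 0⟩ : ℂ)‖ = |x (Sum.inr (Fin.last (m + 1)))| :=
        Complex.norm_real _
      rw [h2, h]
    · rw [foldLast, Sum.elim_inr, Fin.snoc_castSucc, extend_castSucc]

theorem exists_lastRotation {σ : ℝ} (hσ : σ * σ = 1) (v : Ix (m + 1) → ℝ) :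
    ∃ θ, mat (lastRotation m θ) *ᵥ v = extend (foldLast σ v) 0 := by
  have hne : idxA m ≠ idxB m := (Fin.castSucc_lt_last _).ne
  set z : ℂ := ⟨v (Sum.inr (idxA m)), v (Sum.inr (idxB m))⟩ with hz
  -- The rotation of angle `θ` multiplies `z` by `exp (-iθ)`. With `θ = arg (σ z)` and `σ ^ 2 = 1`
  -- the result is the real number `σ ‖z‖`.
  set w : ℂ := σ * z with hw
  have hzw : ‖w‖ = ‖z‖ := by
    have hσ1 : |σ| = 1 := by
      rw [← Real.sqrt_mul_self_eq_abs, hσ, Real.sqrt_one]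
    rw [hw, norm_mul, Complex.norm_real, Real.norm_eq_abs, hσ1, one_mul]
  have h1 : ‖z‖ * Real.cos w.arg = σ * v (Sum.inr (idxA m)) := by
    rw [← hzw, Complex.norm_mul_cos_arg]
    simp [hw, hz]
  have h2 : ‖z‖ * Real.sin w.arg = σ * v (Sum.inr (idxB m)) := by
    rw [← hzw, Complex.norm_mul_sin_arg]
    simp [hw, hz]
  have hcs := Real.cos_sq_add_sin_sq w.arg
  have h3 : Real.cos w.arg * v (Sum.inr (idxA m)) + Real.sin w.arg * v (Sum.inr (idxB m)) =
      σ * ‖z‖ := by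
    linear_combination (-Real.cos w.arg * σ) * h1 + (-Real.sin w.arg * σ) * h2 + σ * ‖z‖ * hcs
      - (Real.cos w.arg * v (Sum.inr (idxA m)) + Real.sin w.arg * v (Sum.inr (idxB m))) * hσ
  have h4 : Real.cos w.arg * v (Sum.inr (idxB m)) - Real.sin w.arg * v (Sum.inr (idxA m)) = 0 := by
    linear_combination (Real.sin w.arg * σ) * h1 - (Real.cos w.arg * σ) * h2
      - (Real.cos w.arg * v (Sum.inr (idxB m)) - Real.sin w.arg * v (Sum.inr (idxA m))) * hσ
  refine ⟨w.arg, ?_⟩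
  rw [lastRotation_mulVec]
  refine extend_ext (fun i => ?_) (fun j => ?_) ?_
  · simp [extend_inl, foldLast]
  · rw [extend_castSucc]
    refine Fin.lastCases ?_ (fun j => ?_) j
    · rw [foldLast, Sum.elim_inr, Fin.snoc_last, ← hz, ← h3]
      simp [hne]
      ring
    · have h5 : j.castSucc.castSucc ≠ idxA m :=
        (Fin.castSucc_lt_castSucc_iff.2 (Fin.castSucc_lt_last j)).ne
      have h6 : j.castSucc.castSucc ≠ idxB m := (Fin.castSucc_lt_last _).ne
      rw [foldLast, Sum.elim_inr, Fin.snoc_castSucc]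
      simp [h5, h6]
  · rw [extend_last]
    simp [hne.symm]
    linear_combination h4

/-! ### Transfer of closures and of the horizon. -/

theorem smul_mem_freePart {K : G m} (hK : ∀ x, IsSing (mat K *ᵥ x) ↔ IsSing x) {p : AdS m} :
    K • p ∈ freePart m ↔ p ∈ freePart m := by
  induction p using QuotientGroup.induction_on with
  | H g =>
    change (QuotientGroup.mk (K * g) : AdS m) ∈ _ ↔ _
    simp only [mk_mem_freePart, mat_mul, ← mulVec_mulVec, hK]

theorem continuous_iota : Continuous (iota m) := by
  refine Continuous.quotient_map' ?_ _
  exact ((embSO_continuous m).comp continuous_subtype_val).subtype_mk _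

/-- A point of `S` near `ι p` folds to a vector near `pt p`, which openness realises as `pt q` with
`q` near `p`. A rotation carries the point of `S` to `ι q`, and `S` is invariant under rotations. -/
theorem mem_closure_of_iota_mem_closure {S : Set (AdS (m + 1))}
    (hS : ∀ θ, ∀ p ∈ S, lastRotation m θ • p ∈ S) {p : AdS m} (hp : iota m p ∈ closure S) :
    p ∈ closure (iota m ⁻¹' S) := by
  obtain ⟨σ, hσ, hfold⟩ := foldLast_extend (pt p)
  refine mem_closure_iff_nhds.2 fun U hU => ?_
  have h1 : Filter.Tendsto (fun p' : AdS (m + 1) => foldLast σ (pt p')) (nhds (iota m p))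
      (nhds (pt p)) := by
    have h := ((continuous_foldLast σ).comp (continuous_pt (m := m + 1))).tendsto (iota m p)
    rwa [Function.comp_apply, pt_iota, hfold] at h
  obtain ⟨p', h2, hp'⟩ := mem_closure_iff_nhds.1 hp _ (h1 (eventually_exists_pt_eq hU))
  obtain ⟨θ, hθ⟩ := exists_lastRotation hσ (pt p')
  -- The folded vector lies on the smaller quadric because rotations are isometries and the appended
  -- coordinate is zero.
  have h3 : ip (foldLast σ (pt p')) (foldLast σ (pt p')) = 1 := by
    have h := ip_extend (foldLast σ (pt p')) (foldLast σ (pt p')) 0 0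
    rw [← hθ, ip_mat, ip_pt] at h
    linarith
  obtain ⟨q, hq, hqv⟩ := h2 h3
  refine ⟨q, hq, ?_⟩
  have h4 : iota m q = lastRotation m θ • p' := by
    refine pt_injective ?_
    rw [pt_iota, hqv, pt_smul, hθ]
  rw [Set.mem_preimage, h4]
  exact hS θ p' hp'

theorem preimage_freePart : iota m ⁻¹' freePart (m + 1) = freePart m :=
  Set.ext fun _ => iota_mem_freePart

theorem preimage_blackHole : iota m ⁻¹' blackHole (m + 1) = blackHole m :=
  Set.ext fun _ => iota_mem_blackHole

theorem horizon_eq : horizon m = closure (blackHole m) ∩ closure (freePart m) := by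
  rw [horizon, frontier_eq_closure_inter_closure, blackHole_eq, compl_compl]

theorem iota_mem_horizon {p : AdS m} : iota m p ∈ horizon (m + 1) ↔ p ∈ horizon m := by
  rw [horizon_eq, horizon_eq]
  constructor
  · rintro ⟨h1, h2⟩
    constructor
    · rw [← preimage_blackHole]
      refine mem_closure_of_iota_mem_closure (fun θ q hq => ?_) h1
      rw [blackHole_eq] at hq ⊢
      exact fun h => hq ((smul_mem_freePart (lastRotation_isSing θ)).1 h)
    · rw [← preimage_freePart]
      exact mem_closure_of_iota_mem_closure
        (fun θ q hq => (smul_mem_freePart (lastRotation_isSing θ)).2 hq) h2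
  · rintro ⟨h1, h2⟩
    exact ⟨map_mem_closure continuous_iota h1 fun _ => iota_mem_blackHole.2,
      map_mem_closure continuous_iota h2 fun _ => iota_mem_freePart.2⟩

end Rotations

end BTZ

theorem mainTheorem5 (m : ℕ) :
    BTZ.iota m '' BTZ.singularity m ⊆ BTZ.singularity (m + 1) ∧
    BTZ.iota m '' BTZ.freePart m ⊆ BTZ.freePart (m + 1) ∧
    BTZ.iota m '' BTZ.blackHole m ⊆ BTZ.blackHole (m + 1) ∧
    BTZ.iota m '' BTZ.horizon m ⊆ BTZ.horizon (m + 1) ∧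
    BTZ.freePart (m + 1) ∩ Set.range (BTZ.iota m) ⊆ BTZ.iota m '' BTZ.freePart m ∧
    BTZ.horizon (m + 1) ∩ Set.range (BTZ.iota m) ⊆ BTZ.iota m '' BTZ.horizon m := by
  refine ⟨?_, ?_, ?_, ?_, ?_, ?_⟩
  · rintro _ ⟨p, hp, rfl⟩
    exact BTZ.iota_mem_singularity.2 hp
  · rintro _ ⟨p, hp, rfl⟩
    exact BTZ.iota_mem_freePart.2 hp
  · rintro _ ⟨p, hp, rfl⟩
    exact BTZ.iota_mem_blackHole.2 hp
  · rintro _ ⟨p, hp, rfl⟩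
    exact BTZ.iota_mem_horizon.2 hp
  · rintro _ ⟨hp, p, rfl⟩
    exact ⟨p, BTZ.iota_mem_freePart.1 hp, rfl⟩
  · rintro _ ⟨hp, p, rfl⟩
    exact ⟨p, BTZ.iota_mem_horizon.1 hp, rfl⟩
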